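/- Let $X$ be a non-empty compact Hausdorff space and let $\pi:\mathcal A\to X$ be a subhomogeneous unital (F) $C^*$-bundle with non-zero fibres. That is: $\pi$ is a continuous open surjection; every fibre $\mathcal A_x=\pi^{-1}(x)$ is a non-zero unital complex $C^*$-algebra; addition and multiplication (on $\mathcal A\times_X\mathcal A$), scalar multiplication, the involution, the norm $\mathcal A\to\mathbb R_{\ge 0}$ and the unit section $x\mapsto 1_{\mathcal A_x}$ are continuous; for every $x$ the sets $\{p : \pi(p)\in U,\ \|p\|<\varepsilon\}$ ($U$ a neighbourhood of $x$, $\varepsilon>0$) form a fundamental system of neighbourhoods of $0_x\in\mathcal A_x$; and $\sup_{x}\dim\mathcal A_x<\infty$. Let $\Gamma(\mathcal A)$ be the $C^*$-algebra of continuous sections, with the supremum norm, and regard $C(X)$ as a subalgebra of it through $f\mapsto f\cdot 1$. A conditional expectation $E:\Gamma(\mathcal A)\to C(X)$ is a linear map of norm $1$ that restricts to the identity on $C(X)$; put $K(E)=\inf\{K\ge 1 : K\cdot E-\mathrm{id}\text{ is a positive map}\}\in[1,\infty]$. For a finite-dimensional $C^*$-algebra $B$ let $r(B)$ be the sum of the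 dimensions of its irreducible representations, one from each unitary equivalence class, and let $r(\mathcal A)=\sup_{x\in X}r(\mathcal A_x)$. The expectation $E$ is optimal if $K(E)=r(\mathcal A)$. For a unital embedding $\iota:\prod_{j}M_{m_j}(\mathbb C)\to\prod_{i}M_{n_i}(\mathbb C)$ of multi-matrix algebras the Bratteli matrix $T=(T_{ij})$ has as its entry $T_{ij}$ the un-normalized trace, in the factor $M_{n_i}(\mathbb C)$, of $\iota(p)$ for a minimal projection $p$ of the factor $M_{m_j}(\mathbb C)$. Bratteli matrices of a unital embedding of arbitrary finite-dimensional $C^*$-algebras are those obtained by identifying both algebras with multi-matrix algebras; they are considered up to automorphisms of both algebras. A Bratteli-matrix germ of $\mathcal A$ at $x\in X$ is obtained by extending the fibre $\mathcal A_x$ to a $(\dim\mathcal A_x)$-homogeneous $C^*$-subbundle $\mathcal B$ of $\mathcal A$ (with the same units, and with $\mathcal B_x=\mathcal A_x$) over a neighbourhood $U$ of $x$, and retaining those matrices $T$ that are Bratteli matrices of the embedding $\mathcal B_y\le\mathcal A_y$ for points $y\in U$ arbitrarily close to $x$. Suppose that for every $x\in X$ and every Bratteli-matrix germ $T=(T_{ij})_{i,j}$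 of $\mathcal A$ at $x$, each column of $T$ has exactly one entry equal to $1$ and all its other entries equal to $0$. Then there is an optimal conditional expectation $E:\Gamma(\mathcal A)\to C(X)$, i.e. one with $K(E)=r(\mathcal A)$. -/

import Mathlib

open Filter Topology
open scoped ENNReal

/-! ### Banach, `*`-algebra and `C^*`-algebra bundles -/

/-- The total space of a family of fibres `A x`, `x : X`. Its topology is part of the data of a
bundle, and is supplied separately. -/
structure TotSpace {X : Type*} (A : X → Type*) where
  /-- the base point (the bundle projection) -/
  pt : X
  /-- the point of the fibre -/
  vec : A pt

/-- The fibred square of the total space over the base: pairs of points of a common fibre. -/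
structure TotSq {X : Type*} (A : X → Type*) where
  pt : X
  fst : A pt
  snd : A pt

/-- The inclusion of the fibred square in the square of the total space. -/
def TotSq.toProd {X : Type*} {A : X → Type*} (p : TotSq A) : TotSpace A × TotSpace A :=
  (⟨p.pt, p.fst⟩, ⟨p.pt, p.snd⟩)

/-- The fibred square carries the subspace topology from the square of the total space. -/
instance TotSq.instTopologicalSpace {X : Type*} {A : X → Type*} [TopologicalSpace (TotSpace A)] :
    TopologicalSpace (TotSq A) :=
  TopologicalSpace.induced TotSq.toProd inferInstance

/-- The topology on the total space makes the family `A` of normed unital complex `*`-algebras a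
continuous ("(F)") unital bundle. When the fibres are (unital) `C^*`-algebras, this is a unital
(F) `C^*`-bundle. -/
class IsUnitalFellBundle {X : Type*} [TopologicalSpace X] (A : X → Type*)
    [∀ x, NormedRing (A x)] [∀ x, StarRing (A x)] [∀ x, NormedAlgebra ℂ (A x)]
    [TopologicalSpace (TotSpace A)] : Prop where
  continuous_proj : Continuous (TotSpace.pt : TotSpace A → X)
  isOpenMap_proj : IsOpenMap (TotSpace.pt : TotSpace A → X)
  continuous_add : Continuous fun p : TotSq A ↦ (⟨p.pt, p.fst + p.snd⟩ : TotSpace A)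
  continuous_smul : Continuous fun p : ℂ × TotSpace A ↦ (⟨p.2.pt, p.1 • p.2.vec⟩ : TotSpace A)
  continuous_mul : Continuous fun p : TotSq A ↦ (⟨p.pt, p.fst * p.snd⟩ : TotSpace A)
  continuous_star : Continuous fun p : TotSpace A ↦ (⟨p.pt, star p.vec⟩ : TotSpace A)
  continuous_one : Continuous fun x : X ↦ (⟨x, 1⟩ : TotSpace A)
  continuous_norm : Continuous fun p : TotSpace A ↦ ‖p.vec‖
  /-- the tubes around zero are a fundamental system of neighbourhoods of the zero element -/
  nhds_zero : ∀ x : X, (𝓝 (⟨x, 0⟩ : TotSpace A)).HasBasis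
    (fun Uε : Set X × ℝ ↦ Uε.1 ∈ 𝓝 x ∧ 0 < Uε.2)
    (fun Uε ↦ {p | p.pt ∈ Uε.1 ∧ ‖p.vec‖ < Uε.2})

/-- Subhomogeneity: the dimensions of the fibres have a finite common bound. -/
def IsSubhomogeneous {X : Type*} (A : X → Type*) [∀ x, AddCommGroup (A x)]
    [∀ x, Module ℂ (A x)] : Prop :=
  ∃ N : ℕ, ∀ x, Module.rank ℂ (A x) ≤ N

/-! ### The section algebra -/

section Sections

variable {X : Type*} [TopologicalSpace X] (A : X → Type*) [∀ x, CStarAlgebra (A x)]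
  [TopologicalSpace (TotSpace A)] [IsUnitalFellBundle A]

/-- The unital `*`-algebra `Γ(A)` of continuous sections, with pointwise operations. -/
def ContSections : StarSubalgebra ℂ (∀ x, A x) where
  carrier := {s | Continuous fun x ↦ (⟨x, s x⟩ : TotSpace A)}
  mul_mem' {s t} hs ht :=
    (IsUnitalFellBundle.continuous_mul (A := A)).comp
      (f := fun x ↦ (⟨x, s x, t x⟩ : TotSq A))
      (continuous_induced_rng.2 (Continuous.prodMk hs ht))
  add_mem' {s t} hs ht :=
    (IsUnitalFellBundle.continuous_add (A := A)).comp
      (f := fun x ↦ (⟨x, s x, t x⟩ : TotSq A))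
      (continuous_induced_rng.2 (Continuous.prodMk hs ht))
  algebraMap_mem' c := by
    have h := (IsUnitalFellBundle.continuous_smul (A := A)).comp
      (Continuous.prodMk (continuous_const (y := c))
        (IsUnitalFellBundle.continuous_one (A := A)))
    simpa [Function.comp_def, Algebra.algebraMap_eq_smul_one] using h
  star_mem' {s} hs := (IsUnitalFellBundle.continuous_star (A := A)).comp hs

variable {A}

/-- The supremum norm of `Γ(A)` (for compact `X`). -/
noncomputable def supNorm (s : ContSections A) : ℝ := ⨆ x, ‖(s : ∀ x, A x) x‖

/-- Over a compact base the supremum defining the norm is that of a bounded set. -/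
theorem bddAbove_norm_section [CompactSpace X] (s : ContSections A) :
    BddAbove (Set.range fun x ↦ ‖(s : ∀ x, A x) x‖) :=
  (isCompact_range ((IsUnitalFellBundle.continuous_norm (A := A)).comp s.2)).bddAbove

/-- Positivity in the algebra `Γ(A)`. -/
def IsPositiveSection (s : ContSections A) : Prop := ∃ t : ContSections A, s = star t * t

variable (A) in
/-- The embedding `C(X) → Γ(A)`, `f ↦ f · 1`. -/
noncomputable def scalarSection (f : C(X, ℂ)) : ContSections A :=
  ⟨fun x ↦ f x • 1, (IsUnitalFellBundle.continuous_smul (A := A)).comp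
    (Continuous.prodMk f.continuous (IsUnitalFellBundle.continuous_one (A := A)))⟩

/-- `E` is a conditional expectation of `Γ(A)` onto its subalgebra `C(X)`: a linear map onto `C(X)`
that is the identity on `C(X)` and has operator norm one. -/
structure IsExpectation [CompactSpace X] (E : ContSections A →ₗ[ℂ] C(X, ℂ)) : Prop where
  map_scalarSection : ∀ f, E (scalarSection A f) = f
  norm_eq_one : IsLeast {C : ℝ | 0 ≤ C ∧ ∀ s, ‖E s‖ ≤ C * supNorm s} 1

/-- The `K`-constant `inf {K ≥ 1 | K · E - id is a positive map}`, equal to `∞` if there is no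
such `K`. -/
noncomputable def kConstant (E : ContSections A →ₗ[ℂ] C(X, ℂ)) : ℝ≥0∞ :=
  ⨅ (K : ℝ) (_ : 1 ≤ K ∧ ∀ s, IsPositiveSection s →
    IsPositiveSection ((K : ℂ) • scalarSection A (E s) - s)), ENNReal.ofReal K

end Sections

/-! ### Irreducible representations and the rank -/

/-- A finite-dimensional irreducible `*`-representation of a unital complex `*`-algebra, on `ℂ ^ n`.
If the algebra is a finite-dimensional `C^*`-algebra then every irreducible representation is
unitarily equivalent to one of these. -/
structure Irrep (B : Type*) [Ring B] [StarRing B] [Algebra ℂ B] where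
  dim : ℕ
  hom : B →⋆ₐ[ℂ] Matrix (Fin dim) (Fin dim) ℂ
  dim_pos : 0 < dim
  irreducible : ∀ W : Submodule ℂ (Fin dim → ℂ),
    (∀ b, ∀ v ∈ W, (hom b).mulVec v ∈ W) → W = ⊥ ∨ W = ⊤

section Rank

variable (B : Type*) [Ring B] [StarRing B] [Algebra ℂ B]

open Matrix in
/-- Unitary equivalence of irreducible representations. -/
instance Irrep.setoid : Setoid (Irrep B) where
  r p q := ∃ u : Matrix (Fin q.dim) (Fin p.dim) ℂ,
    uᴴ * u = 1 ∧ u * uᴴ = 1 ∧ ∀ b, u * p.hom b = q.hom b * u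
  iseqv :=
    { refl := fun p ↦ ⟨1, by simp, by simp, by simp⟩
      symm := by
        rintro p q ⟨u, h1, h2, h⟩
        refine ⟨uᴴ, by simpa using h2, by simpa using h1, fun b ↦ ?_⟩
        calc uᴴ * q.hom b = uᴴ * (q.hom b * u) * uᴴ := by
              rw [Matrix.mul_assoc, Matrix.mul_assoc, h2, Matrix.mul_one]
          _ = p.hom b * uᴴ := by
              rw [← h, ← Matrix.mul_assoc, h1, Matrix.one_mul]
      trans := by
        rintro p q r ⟨u, h1, h2, h⟩ ⟨v, k1, k2, k⟩
        refine ⟨v * u, ?_, ?_, fun b ↦ ?_⟩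
        · rw [Matrix.conjTranspose_mul, Matrix.mul_assoc, ← Matrix.mul_assoc vᴴ, k1,
            Matrix.one_mul, h1]
        · rw [Matrix.conjTranspose_mul, Matrix.mul_assoc, ← Matrix.mul_assoc u, h2,
            Matrix.one_mul, k2]
        · rw [Matrix.mul_assoc, h, ← Matrix.mul_assoc, k, Matrix.mul_assoc] }

/-- The dimension of a unitary equivalence class of irreducible representations. -/
def Irrep.classDim : Quotient (Irrep.setoid B) → ℕ :=
  Quotient.lift Irrep.dim (by
    rintro p q ⟨u, h1, h2, -⟩
    simpa using (Matrix.square_of_invertible u (Matrix.conjTranspose u) h2 h1).symm)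

/-- `r(B)`: the sum of the dimensions of the irreducible representations of `B`, one for each
unitary equivalence class. -/
noncomputable def algRank : ℝ≥0∞ := ∑' c : Quotient (Irrep.setoid B), (Irrep.classDim B c : ℝ≥0∞)

end Rank

/-- `r(A)`: the supremum of the ranks of the fibres. -/
noncomputable def bundleRank {X : Type*} (A : X → Type*) [∀ x, Ring (A x)] [∀ x, StarRing (A x)]
    [∀ x, Algebra ℂ (A x)] : ℝ≥0∞ :=
  ⨆ x, algRank (A x)

/-- The conditional expectation `E : Γ(A) → C(X)` is optimal: `K(E) = r(A)`. -/
structure IsOptimalExpectation {X : Type*} [TopologicalSpace X] [CompactSpace X] {A : X → Type*}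
    [∀ x, CStarAlgebra (A x)] [TopologicalSpace (TotSpace A)] [IsUnitalFellBundle A]
    (E : ContSections A →ₗ[ℂ] C(X, ℂ)) : Prop where
  isExpectation : IsExpectation E
  kConstant_eq : kConstant E = bundleRank A

/-! ### Bratteli matrices and their germs -/

/-- The multi-matrix algebra `M_{n_1} × ⋯ × M_{n_k}`. -/
abbrev MultiMatrix {k : ℕ} (n : Fin k → ℕ) : Type :=
  ∀ i, Matrix (Fin (n i)) (Fin (n i)) ℂ

/-- Minimal projections of a `*`-algebra. -/
def IsMinimalProjection {B : Type*} [Ring B] [StarRing B] [Algebra ℂ B] (p : B) : Prop :=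
  IsStarProjection p ∧ p ≠ 0 ∧ ∀ b, ∃ c : ℂ, p * b * p = c • p

/-- `T` is a Bratteli matrix of the unital embedding `ι : B → C` of finite-dimensional
`C^*`-algebras: after identifying `B` and `C` with multi-matrix algebras, `T i j` is the
un-normalized trace, in the `i`-th factor of `C`, of the image of any minimal projection of the
`j`-th factor of `B`. As the identifications are arbitrary, the matrices `T` that arise are those
conjugate to a given one under automorphisms of `B` and `C`. -/
def IsBratteliMatrix {B C : Type*} [Ring B] [StarRing B] [Algebra ℂ B]
    [Ring C] [StarRing C] [Algebra ℂ C] (ι : B →⋆ₐ[ℂ] C)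
    {l k : ℕ} (T : Matrix (Fin l) (Fin k) ℕ) : Prop :=
  ∃ (m : Fin k → ℕ) (n : Fin l → ℕ), (∀ j, 0 < m j) ∧ (∀ i, 0 < n i) ∧
    ∃ (φ : B ≃⋆ₐ[ℂ] MultiMatrix m) (ψ : C ≃⋆ₐ[ℂ] MultiMatrix n),
      ∀ i j, ∀ p : Matrix (Fin (m j)) (Fin (m j)) ℂ, IsMinimalProjection p →
        Matrix.trace (ψ (ι (φ.symm (Pi.single j p))) i) = (T i j : ℂ)

section Germs

variable {X : Type*} [TopologicalSpace X] (A : X → Type*) [∀ x, CStarAlgebra (A x)]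
  [TopologicalSpace (TotSpace A)]

/-- The total space of a family of `*`-subalgebras of the fibres over a subset of the base carries
the subspace topology. -/
instance TotSpace.instTopologicalSpaceSub {U : Set X} (B : ∀ y : U, StarSubalgebra ℂ (A y)) :
    TopologicalSpace (TotSpace fun y : U ↦ B y) :=
  TopologicalSpace.induced (fun p ↦ (⟨p.pt, p.vec⟩ : TotSpace A)) inferInstance

/-- `B` is an extension of the fibre `A x` to a `(dim A x)`-homogeneous `C^*`-subbundle of `A` over
the neighbourhood `U` of `x` (with the unit of `A`). -/
structure IsFiberExtension (x : X) (U : Set X) (B : ∀ y : U, StarSubalgebra ℂ (A y)) : Prop where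
  mem_nhds : U ∈ 𝓝 x
  fiber_eq : B ⟨x, mem_of_mem_nhds mem_nhds⟩ = ⊤
  finiteDimensional : ∀ y : U, FiniteDimensional ℂ (B y)
  finrank_eq : ∀ y : U, Module.finrank ℂ (B y) = Module.finrank ℂ (A x)
  isBundle : IsUnitalFellBundle fun y : U ↦ B y

/-- `T` is (a representative of) a Bratteli-matrix germ of the bundle at `x`: for an extension `B`
of the fibre `A x` to a homogeneous bundle around `x`, it is a Bratteli matrix of embeddings
`B y ≤ A y` for points `y` arbitrarily close to `x`. -/
def IsBratteliGerm (x : X) {l k : ℕ} (T : Matrix (Fin l) (Fin k) ℕ) : Prop :=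
  ∃ (U : Set X) (B : ∀ y : U, StarSubalgebra ℂ (A y)), IsFiberExtension A x U B ∧
    ∃ᶠ y in 𝓝 x, ∃ hy : y ∈ U, IsBratteliMatrix (B ⟨y, hy⟩).subtype T

end Germs

/-- All columns have exactly one entry equal to `1` and all their other entries equal to `0`. -/
def HasSingletonColumns {l k : ℕ} (T : Matrix (Fin l) (Fin k) ℕ) : Prop :=
  ∀ j, ∃ i, T i j = 1 ∧ ∀ i', i' ≠ i → T i' j = 0

/-! ### Continuous sections: existence, approximation and functional calculus -/

section Bundle

set_option linter.unusedSectionVars false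

variable {X : Type*} [TopologicalSpace X] {A : X → Type*} [∀ x, CStarAlgebra (A x)]
  [TopologicalSpace (TotSpace A)] [IsUnitalFellBundle A]

/-! A finite-dimensional `C^*`-algebra `B` carries a canonical trace `τ`, equal to one on every
minimal projection, and `τ 1 = r(B)`. For `a ≥ 0` one has `a ≤ τ(a) · 1`, since the spectral
projection of an eigenvalue has trace at least one. Hence `K · τ(1)⁻¹ τ - id` is positive for `K =
r(B)`, and testing it on a minimal projection shows that no smaller `K` will do. Normalizing the
canonical traces of all the fibres therefore gives the required `E`, provided that `y ↦ τ y (s y)`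
is continuous for each continuous section `s` (`kConstant_traceExpectation`,
`isExpectation_traceExpectation`).

Continuity is where the Bratteli matrices enter. Matrix units of the fibre over `x` extend to
continuous sections that are matrix units of nearby fibres (`exists_lift_matrixSystem`), and these
span a homogeneous subbundle extending that fibre. A column sum of a Bratteli matrix bounds the
number of minimal projections of the large fibre into which a minimal projection of the subbundle
splits, so singleton columns mean that it stays minimal. Dimensions being bounded, only finitely
many matrices occur; if minimality failed arbitrarily close to `x`, one bad matrix would recur there
and be a forbidden germ (`exists_local_minimal_partition`). Thus the unit is, near `x`, a sum of
continuous sections `P i` with minimal values. The trace is then the sum of the scalars `c i` with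
`P i * s * P i = c i • P i`, and these vary continuously because the norm does
(`continuous_canonicalTrace`).

Extending elements of a fibre at all requires enough continuous sections. These are built by
successively improving discontinuous approximate sections with partitions of unity
(`exists_contSection_near`), and finite-dimensionality makes the prescribed value exact
(`exists_contSection_eq`). -/

theorem mem_contSections {s : ∀ x, A x} :
    s ∈ ContSections A ↔ Continuous fun x ↦ (⟨x, s x⟩ : TotSpace A) := Iff.rfl

theorem exists_nhds_of_continuous_totSq {Z : Type*} [TopologicalSpace Z]
    {g : TotSq A → Z} (hg : Continuous g) {x : X} (a b : A x) {O : Set Z}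
    (hO : O ∈ 𝓝 (g ⟨x, a, b⟩)) :
    ∃ V ∈ 𝓝 (⟨x, a⟩ : TotSpace A), ∃ W ∈ 𝓝 (⟨x, b⟩ : TotSpace A),
      ∀ y (a' b' : A y), (⟨y, a'⟩ : TotSpace A) ∈ V → (⟨y, b'⟩ : TotSpace A) ∈ W →
        g ⟨y, a', b'⟩ ∈ O := by
  have h := hg.continuousAt.preimage_mem_nhds hO
  rw [nhds_induced, mem_comap] at h
  obtain ⟨t, ht, hts⟩ := h
  obtain ⟨V, hV, W, hW, hVW⟩ := mem_nhds_prod_iff.1 ht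
  exact ⟨V, hV, W, hW, fun y a' b' ha hb ↦ hts (hVW ⟨ha, hb⟩)⟩

/-- This is the form in which openness of the projection is used: nearby fibres meet every
neighbourhood. -/
theorem eventually_exists_mem {x : X} {a : A x} {V : Set (TotSpace A)}
    (hV : V ∈ 𝓝 (⟨x, a⟩ : TotSpace A)) : ∀ᶠ y in 𝓝 x, ∃ b : A y, (⟨y, b⟩ : TotSpace A) ∈ V := by
  filter_upwards [(IsUnitalFellBundle.isOpenMap_proj (A := A)).image_mem_nhds hV]
  rintro _ ⟨⟨y, b⟩, h, rfl⟩
  exact ⟨b, h⟩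

theorem eventually_pt {x : X} (a : A x) {P : X → Prop} (h : ∀ᶠ y in 𝓝 x, P y) :
    ∀ᶠ q in 𝓝 (⟨x, a⟩ : TotSpace A), P q.pt :=
  (IsUnitalFellBundle.continuous_proj (A := A)).continuousAt.preimage_mem_nhds
    (x := (⟨x, a⟩ : TotSpace A)) h

theorem eventually_norm_lt {x : X} (a : A x) {e : ℝ} (h : ‖a‖ < e) :
    ∀ᶠ q in 𝓝 (⟨x, a⟩ : TotSpace A), ‖q.vec‖ < e :=
  (IsUnitalFellBundle.continuous_norm (A := A)).continuousAt.preimage_mem_nhds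
    (x := (⟨x, a⟩ : TotSpace A)) (Iio_mem_nhds h)

theorem continuous_norm_sub :
    Continuous fun p : TotSq A ↦ ‖p.fst - p.snd‖ := by
  have h1 : Continuous fun p : TotSq A ↦ (⟨p.pt, p.fst⟩ : TotSpace A) :=
    continuous_fst.comp (continuous_induced_dom (f := TotSq.toProd))
  have h2 : Continuous fun p : TotSq A ↦ (⟨p.pt, p.snd⟩ : TotSpace A) :=
    continuous_snd.comp (continuous_induced_dom (f := TotSq.toProd))
  have h3 : Continuous fun p : TotSq A ↦ (⟨p.pt, (-1 : ℂ) • p.snd⟩ : TotSpace A) :=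
    (IsUnitalFellBundle.continuous_smul (A := A)).comp (continuous_const.prodMk h2)
  have h4 : Continuous fun p : TotSq A ↦ (⟨p.pt, p.fst, (-1 : ℂ) • p.snd⟩ : TotSq A) :=
    continuous_induced_rng.2 (h1.prodMk h3)
  have h5 := (IsUnitalFellBundle.continuous_norm (A := A)).comp
    ((IsUnitalFellBundle.continuous_add (A := A)).comp h4)
  refine h5.congr fun p ↦ ?_
  simp [sub_eq_add_neg]

theorem exists_nhds_norm_sub_lt {x : X} (a b : A x) {ε : ℝ} (h : ‖a - b‖ < ε) :
    ∃ V ∈ 𝓝 (⟨x, a⟩ : TotSpace A), ∃ W ∈ 𝓝 (⟨x, b⟩ : TotSpace A),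
      ∀ y (a' b' : A y), (⟨y, a'⟩ : TotSpace A) ∈ V → (⟨y, b'⟩ : TotSpace A) ∈ W →
        ‖a' - b'‖ < ε :=
  exists_nhds_of_continuous_totSq continuous_norm_sub a b (Iio_mem_nhds h)

/-- Every neighbourhood of a point of the total space contains a tube around a neighbourhood. -/
theorem exists_nhds_tube {x : X} (a : A x) {O : Set (TotSpace A)}
    (hO : O ∈ 𝓝 (⟨x, a⟩ : TotSpace A)) :
    ∃ V ∈ 𝓝 (⟨x, a⟩ : TotSpace A), ∃ ε > 0, ∀ y (b c : A y), (⟨y, b⟩ : TotSpace A) ∈ V →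
      ‖c - b‖ < ε → (⟨y, c⟩ : TotSpace A) ∈ O := by
  obtain ⟨V, hV, W, hW, h⟩ := exists_nhds_of_continuous_totSq
    (IsUnitalFellBundle.continuous_add (A := A)) a 0 (O := O) (by simpa using hO)
  obtain ⟨⟨U, ε⟩, ⟨hU, hε⟩, hUW⟩ := (IsUnitalFellBundle.nhds_zero x).mem_iff.1 hW
  refine ⟨V ∩ TotSpace.pt ⁻¹' U, inter_mem hV
    ((IsUnitalFellBundle.continuous_proj (A := A)).continuousAt.preimage_mem_nhds hU), ε, hε,
    fun y b c hb hc ↦ ?_⟩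
  have := h y b (c - b) hb.1 (hUW ⟨hb.2, hc⟩)
  simpa using this

/-- At the point `a` of the fibre over `x`, the (possibly discontinuous) section `s` is
asymptotically within distance `e` of all nearby points of the total space. -/
def IsNearAt (s : ∀ x, A x) (x : X) (a : A x) (e : ℝ) : Prop :=
  ∀ η > 0, ∀ᶠ q in 𝓝 (⟨x, a⟩ : TotSpace A), ‖q.vec - s q.pt‖ < e + η

theorem IsNearAt.of_lt {s : ∀ x, A x} {x : X} {a : A x} {e : ℝ}
    (h : ∀ᶠ q in 𝓝 (⟨x, a⟩ : TotSpace A), ‖q.vec - s q.pt‖ ≤ e) : IsNearAt s x a e :=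
  fun η hη ↦ h.mono fun q hq ↦ by linarith

theorem IsNearAt.norm_sub_le {s : ∀ x, A x} {x : X} {a : A x} {e : ℝ}
    (h : IsNearAt s x a e) : ‖a - s x‖ ≤ e :=
  le_of_forall_pos_lt_add fun η hη ↦ (h η hη).self_of_nhds

theorem IsNearAt.mono {s : ∀ x, A x} {x : X} {a : A x} {e e' : ℝ}
    (h : IsNearAt s x a e) (he : e ≤ e') : IsNearAt s x a e' :=
  fun η hη ↦ (h η hη).mono fun q hq ↦ by linarith

theorem IsNearAt.of_norm_sub_le {s t : ∀ x, A x} {x : X} {a : A x} {e d : ℝ}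
    (h : IsNearAt s x a e) (hst : ∀ y, ‖s y - t y‖ ≤ d) : IsNearAt t x a (e + d) :=
  fun η hη ↦ (h η hη).mono fun q hq ↦ by
    have := norm_sub_le_norm_sub_add_norm_sub q.vec (s q.pt) (t q.pt)
    linarith [hst q.pt]

theorem isNearAt_zero (x : X) : IsNearAt (0 : ∀ x, A x) x 0 0 := by
  intro η hη
  simpa using eventually_norm_lt (0 : A x) (e := η) (by simpa using hη)

theorem IsNearAt.add {s t : ∀ x, A x} {x : X} {a b : A x} {d e : ℝ}
    (hs : IsNearAt s x a d) (ht : IsNearAt t x b e) : IsNearAt (s + t) x (a + b) (d + e) := by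
  intro η hη
  obtain ⟨V, hV, W, hW, h⟩ := exists_nhds_norm_sub_lt (a + b) (a + b) (ε := η / 3)
    (by simp; positivity)
  obtain ⟨V', hV', W', hW', h'⟩ := exists_nhds_of_continuous_totSq
    (IsUnitalFellBundle.continuous_add (A := A)) a b hW
  -- A point `q` near `a + b` comes with no splitting. Openness supplies `a'` and `b'` in its fibre
  -- near `a` and `b`, and then `a' + b'` is close to `q`.
  have h1 := eventually_exists_mem (inter_mem hV' (hs (η / 3) (by positivity)))
  have h2 := eventually_exists_mem (inter_mem hW' (ht (η / 3) (by positivity)))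
  have h3 := eventually_pt (a + b) (h1.and h2)
  filter_upwards [h3, hV]
  rintro ⟨y, q⟩ ⟨⟨a', ha', ha⟩, ⟨b', hb', hb⟩⟩ hq
  have k := h y q _ hq (h' y a' b' ha' hb')
  simp only [Set.mem_ofPred_eq, Pi.add_apply] at ha hb ⊢
  have : q - (s y + t y) = (q - (a' + b')) + (a' - s y) + (b' - t y) := by abel
  rw [this]
  have := norm_add₃_le (a := q - (a' + b')) (b := a' - s y) (c := b' - t y)
  linarith

theorem IsNearAt.smul {s : ∀ x, A x} {x : X} {a : A x} {e : ℝ} (hs : IsNearAt s x a e)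
    {f : X → ℂ} (hf : Continuous f) : IsNearAt (fun y ↦ f y • s y) x (f x • a) (‖f x‖ * e) := by
  intro η hη
  have he : 0 ≤ e := (norm_nonneg _).trans hs.norm_sub_le
  obtain ⟨V, hV, W, hW, h⟩ := exists_nhds_norm_sub_lt (f x • a) (f x • a) (ε := η / 3)
    (by simp; positivity)
  have hc : Continuous fun q : TotSpace A ↦ (⟨q.pt, f q.pt • q.vec⟩ : TotSpace A) :=
    (IsUnitalFellBundle.continuous_smul (A := A)).comp
      ((hf.comp (IsUnitalFellBundle.continuous_proj (A := A))).prodMk continuous_id)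
  have h0 := hc.continuousAt (x := ⟨x, a⟩).preimage_mem_nhds hW
  obtain ⟨ζ, hζ, hζ'⟩ : ∃ ζ > 0, ‖f x‖ * ζ < η / 3 := by
    refine ⟨η / 3 / (‖f x‖ + 1), by positivity, ?_⟩
    rw [mul_div_assoc', div_lt_iff₀ (by positivity)]
    nlinarith [norm_nonneg (f x)]
  have h1 := eventually_exists_mem (inter_mem h0 (hs ζ hζ))
  have h4 : ∀ᶠ y in 𝓝 x, ‖f y‖ * (e + ζ) < ‖f x‖ * (e + ζ) + η / 3 :=
    (hf.norm.mul continuous_const).continuousAt.eventually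
      (Iio_mem_nhds (lt_add_of_pos_right _ (by positivity)))
  have h3 := eventually_pt (f x • a) (h1.and h4)
  filter_upwards [h3, hV]
  rintro ⟨y, q⟩ ⟨⟨a', ha', ha⟩, hfy⟩ hq
  have k := h y q _ hq ha'
  simp only [Set.mem_ofPred_eq] at ha hfy ⊢
  have e1 : q - f y • s y = (q - f y • a') + f y • (a' - s y) := by rw [smul_sub]; abel
  rw [e1]
  have e2 := norm_add_le (q - f y • a') (f y • (a' - s y))
  rw [norm_smul] at e2
  have e3 : ‖f y‖ * ‖a' - s y‖ ≤ ‖f y‖ * (e + ζ) :=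
    mul_le_mul_of_nonneg_left ha.le (norm_nonneg _)
  linarith

theorem IsNearAt.sum {ι : Type*} (F : Finset ι) {s : ι → ∀ x, A x} {x : X} {a : ι → A x}
    {e : ι → ℝ} (h : ∀ i ∈ F, IsNearAt (s i) x (a i) (e i)) :
    IsNearAt (∑ i ∈ F, s i) x (∑ i ∈ F, a i) (∑ i ∈ F, e i) := by
  classical
  induction F using Finset.induction_on with
  | empty => simpa using isNearAt_zero x
  | insert i F hi ih =>
    rw [Finset.sum_insert hi, Finset.sum_insert hi, Finset.sum_insert hi]
    exact (h i (by simp)).add (ih fun j hj ↦ h j (by simp [hj]))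

theorem isNearAt_of_mem_contSections {s : ∀ x, A x} (hs : s ∈ ContSections A) (x : X) :
    IsNearAt s x (s x) 0 := by
  intro η hη
  obtain ⟨V, hV, W, hW, h⟩ := exists_nhds_norm_sub_lt (s x) (s x) (ε := η) (by simpa using hη)
  have h1 := (mem_contSections.1 hs).continuousAt.preimage_mem_nhds hW
  filter_upwards [hV, (IsUnitalFellBundle.continuous_proj (A := A)).continuousAt.preimage_mem_nhds
    (x := ⟨x, s x⟩) h1]
  rintro ⟨y, q⟩ hq hy
  simpa using h y q _ hq hy

/-- Near `x`, `s y` is close to points of the total space near `a`; these are close to points near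
`s x`, because `‖a - s x‖` is small. A tube around points near `s x` then catches `s y`. -/
theorem mem_contSections_of_isNearAt {s : ∀ x, A x}
    (h : ∀ x, ∀ e > 0, ∃ a, IsNearAt s x a e) : s ∈ ContSections A := by
  rw [mem_contSections, continuous_iff_continuousAt]
  intro x O hO
  obtain ⟨V, hV, ε, hε, hVO⟩ := exists_nhds_tube (s x) hO
  obtain ⟨a, ha⟩ := h x (ε / 4) (by positivity)
  obtain ⟨V₁, hV₁, W₁, hW₁, h1⟩ := exists_nhds_norm_sub_lt (s x) a (ε := ε / 2)
    (by rw [norm_sub_rev]; linarith [ha.norm_sub_le])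
  have h2 := eventually_exists_mem (inter_mem hV hV₁)
  have h3 := eventually_exists_mem (inter_mem hW₁ (ha (ε / 4) (by positivity)))
  rw [mem_map]
  filter_upwards [h2, h3]
  rintro y ⟨b, hb, hb₁⟩ ⟨c, hc, hc₁⟩
  refine hVO y b _ hb ?_
  have k := h1 y b c hb₁ hc
  simp only [Set.mem_ofPred_eq] at hc₁
  have := norm_sub_le_norm_sub_add_norm_sub b c (s y)
  rw [norm_sub_rev]
  linarith

theorem mem_contSections_of_uniform_limit {s : ∀ x, A x}
    (h : ∀ e > 0, ∃ t ∈ ContSections A, ∀ y, ‖t y - s y‖ ≤ e) : s ∈ ContSections A := by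
  refine mem_contSections_of_isNearAt fun x e he ↦ ?_
  obtain ⟨t, ht, hts⟩ := h e he
  exact ⟨t x, by simpa using (isNearAt_of_mem_contSections ht x).of_norm_sub_le hts⟩

/-- Around each `a x` take an open set of fibrewise diameter below `d`, all of whose points are
within `e'` of `s`. An arbitrary choice of points in it is near to within `d`, however
discontinuous, and a partition of unity glues finitely many such choices. -/
theorem exists_isNearAt_refinement [CompactSpace X] [T2Space X] {s : ∀ x, A x} {e : ℝ}
    (hs : ∀ x, ∃ a, IsNearAt s x a e) {e' d : ℝ} (he : e < e') (hd : 0 < d) :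
    ∃ t : ∀ x, A x, (∀ x, ∃ a, IsNearAt t x a d) ∧ ∀ x, ‖s x - t x‖ ≤ e' := by
  classical
  choose a ha using hs
  have h1 : ∀ x, ∃ W : Set (TotSpace A), IsOpen W ∧ ⟨x, a x⟩ ∈ W ∧
      (∀ y (b : A y), (⟨y, b⟩ : TotSpace A) ∈ W → ‖b - s y‖ < e') ∧
      ∀ y (b c : A y), (⟨y, b⟩ : TotSpace A) ∈ W → (⟨y, c⟩ : TotSpace A) ∈ W → ‖b - c‖ < d := by
    intro x
    obtain ⟨V, hV, V', hV', h⟩ := exists_nhds_norm_sub_lt (a x) (a x) (ε := d) (by simpa using hd)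
    have h2 := ha x (e' - e) (by linarith)
    obtain ⟨W, hW, hWo, hx⟩ := mem_nhds_iff.1 (inter_mem (inter_mem hV hV') h2)
    refine ⟨W, hWo, hx, fun y b hb ↦ ?_, fun y b c hb hc ↦ h y b c (hW hb).1.1 (hW hc).1.2⟩
    have := (hW hb).2
    simp only [Set.mem_ofPred_eq] at this
    linarith
  choose W hWo hxW hWs hWd using h1
  obtain ⟨F, hF⟩ := isCompact_univ.elim_finite_subcover (fun x ↦ TotSpace.pt '' (W x))
    (fun x ↦ IsUnitalFellBundle.isOpenMap_proj (A := A) _ (hWo x))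
    (fun x _ ↦ Set.mem_iUnion.2 ⟨x, _, hxW x, rfl⟩)
  obtain ⟨ρ, hρ⟩ := PartitionOfUnity.exists_isSubordinate (s := (Set.univ : Set X)) isClosed_univ
    (fun i : F ↦ TotSpace.pt '' (W i)) (fun i : F ↦ IsUnitalFellBundle.isOpenMap_proj (A := A) _ (hWo i))
    (fun x hx ↦ by
      obtain ⟨i, hi, h⟩ := Set.mem_iUnion₂.1 (hF hx)
      exact Set.mem_iUnion.2 ⟨⟨i, hi⟩, h⟩)
  have hsum : ∀ x, ∑ i : F, ρ i x = 1 := fun x ↦ by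
    rw [← finsum_eq_sum_of_fintype]; exact ρ.sum_eq_one (Set.mem_univ x)
  -- The default value `s y` keeps `t i` within `e'` of `s` everywhere.
  let t : F → ∀ y, A y := fun i y ↦ if h : ∃ b : A y, (⟨y, b⟩ : TotSpace A) ∈ W i then h.choose
    else s y
  have ht : ∀ (i : F) y, (∃ b : A y, (⟨y, b⟩ : TotSpace A) ∈ W i) → (⟨y, t i y⟩ : TotSpace A) ∈ W i := by
    intro i y h
    simp only [t, dif_pos h]
    exact h.choose_spec
  have he0 : 0 ≤ e ∨ IsEmpty X := by
    rcases isEmpty_or_nonempty X with h | ⟨⟨x⟩⟩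
    · exact Or.inr h
    · exact Or.inl ((norm_nonneg _).trans (ha x).norm_sub_le)
  rcases he0 with he0 | h0
  swap
  · exact ⟨s, fun x ↦ h0.elim x, fun x ↦ h0.elim x⟩
  have hts : ∀ i y, ‖s y - t i y‖ ≤ e' := by
    intro i y
    by_cases h : ∃ b : A y, (⟨y, b⟩ : TotSpace A) ∈ W i
    · rw [norm_sub_rev]; exact (hWs _ _ _ (ht i y h)).le
    · simp only [t, dif_neg h]; simp; linarith
  refine ⟨∑ i : F, fun y ↦ ((ρ i y : ℝ) : ℂ) • t i y, fun x ↦ ?_, fun x ↦ ?_⟩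
  · have key : ∀ i : F, ∃ b : A x, IsNearAt (fun y ↦ ((ρ i y : ℝ) : ℂ) • t i y) x b (ρ i x * d) := by
      intro i
      have hc : Continuous fun y ↦ ((ρ i y : ℝ) : ℂ) :=
        Complex.continuous_ofReal.comp (ρ i).continuous
      by_cases h : ρ i x = 0
      -- Outside the support only the crude bound through `s` is available, but it is multiplied by
      -- `ρ i x = 0`.
      · refine ⟨_, (((ha x).of_norm_sub_le (hts i)).smul hc).mono ?_⟩
        simp [h]
      · obtain ⟨⟨_, b⟩, hb, rfl⟩ := hρ i (subset_tsupport _ h)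
        refine ⟨_, (IsNearAt.smul (a := b) (e := d) (IsNearAt.of_lt ?_) hc).mono ?_⟩
        · filter_upwards [(hWo i).mem_nhds hb]
          rintro ⟨y, q⟩ hq
          exact (hWd _ _ _ _ hq (ht i y ⟨q, hq⟩)).le
        · simp [abs_of_nonneg (ρ.nonneg i _)]
    choose b hb using key
    refine ⟨_, (IsNearAt.sum Finset.univ fun i _ ↦ hb i).mono ?_⟩
    rw [← Finset.sum_mul, hsum, one_mul]
  · have e1 : s x - (∑ i : F, fun y ↦ ((ρ i y : ℝ) : ℂ) • t i y) x
        = ∑ i : F, ((ρ i x : ℝ) : ℂ) • (s x - t i x) := by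
      simp only [smul_sub, Finset.sum_sub_distrib, ← Finset.sum_smul, Finset.sum_apply]
      rw [← Complex.ofReal_sum, hsum]; simp
    rw [e1]
    refine (norm_sum_le _ _).trans ?_
    calc ∑ i : F, ‖((ρ i x : ℝ) : ℂ) • (s x - t i x)‖ ≤ ∑ i : F, ρ i x * e' := by
          refine Finset.sum_le_sum fun i _ ↦ ?_
          rw [norm_smul, Complex.norm_real, Real.norm_of_nonneg (ρ.nonneg i x)]
          exact mul_le_mul_of_nonneg_left (hts i x) (ρ.nonneg i x)
      _ = e' := by rw [← Finset.sum_mul, hsum, one_mul]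

/-- Iterating the refinement with errors `e / 2 ^ n` moves the section by at most `2 * e / 2 ^ n` at
each stage. The uniform limit is near to within every positive error, hence continuous, and the
moves add up to `4 * e`. -/
theorem exists_contSection_near [CompactSpace X] [T2Space X] {s : ∀ x, A x} {e : ℝ}
    (he : 0 < e) (hs : ∀ x, ∃ a, IsNearAt s x a e) :
    ∃ t ∈ ContSections A, ∀ x, ‖s x - t x‖ ≤ 4 * e := by
  have key : ∀ (n : ℕ) (s : {s : ∀ x, A x // ∀ x, ∃ a, IsNearAt s x a (e / 2 ^ n)}),
      ∃ t : {s : ∀ x, A x // ∀ x, ∃ a, IsNearAt s x a (e / 2 ^ (n + 1))},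
        ∀ x, ‖s.1 x - t.1 x‖ ≤ 2 * e / 2 ^ n := by
    intro n s
    obtain ⟨t, ht, hst⟩ := exists_isNearAt_refinement s.2 (e' := 2 * e / 2 ^ n)
      (d := e / 2 ^ (n + 1)) (by gcongr; linarith) (by positivity)
    exact ⟨⟨t, ht⟩, hst⟩
  choose next hnext using key
  let σ : ∀ n : ℕ, {s : ∀ x, A x // ∀ x, ∃ a, IsNearAt s x a (e / 2 ^ n)} := fun n ↦
    Nat.rec (motive := fun n ↦ {s : ∀ x, A x // ∀ x, ∃ a, IsNearAt s x a (e / 2 ^ n)})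
      ⟨s, by simpa using hs⟩ (fun n t ↦ next n t) n
  have hσ : ∀ x n, dist ((σ n).1 x) ((σ (n + 1)).1 x) ≤ 4 * e / 2 / 2 ^ n := by
    intro x n
    rw [dist_eq_norm]
    refine (hnext n (σ n) x).trans (le_of_eq (by ring))
  have hlim : ∀ x, ∃ b : A x, Tendsto (fun n ↦ (σ n).1 x) atTop (𝓝 b) := fun x ↦
    cauchySeq_tendsto_of_complete (cauchySeq_of_le_geometric_two (hσ x))
  choose t ht using hlim
  refine ⟨t, mem_contSections_of_isNearAt fun x δ hδ ↦ ?_, fun x ↦ ?_⟩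
  · have h0 : Tendsto (fun n : ℕ ↦ e / 2 ^ n + 4 * e / 2 ^ n) atTop (𝓝 0) := by
      have h := (tendsto_pow_atTop_nhds_zero_of_lt_one (r := (1 / 2 : ℝ)) (by norm_num)
        (by norm_num)).const_mul (5 * e)
      rw [mul_zero] at h
      refine h.congr fun n ↦ ?_
      rw [one_div, inv_pow]; ring
    obtain ⟨n, hn⟩ := (h0.eventually (Iio_mem_nhds hδ)).exists
    obtain ⟨a, ha⟩ := (σ n).2 x
    refine ⟨a, (ha.of_norm_sub_le (t := t) (d := 4 * e / 2 ^ n) fun y ↦ ?_).mono (le_of_lt hn)⟩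
    rw [← dist_eq_norm]
    exact dist_le_of_le_geometric_two_of_tendsto (hσ y) (ht y) n
  · rw [← dist_eq_norm]
    exact dist_le_of_le_geometric_two_of_tendsto₀ (hσ x) (ht x)

/-- A local choice of points near `a`, multiplied by a bump function equal to one at `x`, is near to
within `ε`. Passing to a continuous section costs `4 * ε`, and the choice at `x` itself another `ε`.
-/
theorem exists_contSection_norm_sub_le [CompactSpace X] [T2Space X] {x : X} (a : A x) {ε : ℝ}
    (hε : 0 < ε) : ∃ s ∈ ContSections A, ‖a - s x‖ ≤ 5 * ε := by
  classical
  obtain ⟨V, hV, V', hV', h⟩ := exists_nhds_norm_sub_lt a a (ε := ε) (by simpa using hε)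
  have h2 := eventually_norm_lt a (e := ‖a‖ + 1) (by simp)
  obtain ⟨W, hW, hWo, hx⟩ := mem_nhds_iff.1 (inter_mem (inter_mem hV hV') h2)
  have hU := IsUnitalFellBundle.isOpenMap_proj (A := A) _ hWo
  let t : ∀ y, A y := fun y ↦ if h : ∃ b : A y, (⟨y, b⟩ : TotSpace A) ∈ W then h.choose else 0
  have ht : ∀ y, (∃ b : A y, (⟨y, b⟩ : TotSpace A) ∈ W) → (⟨y, t y⟩ : TotSpace A) ∈ W := by
    intro y h
    simp only [t, dif_pos h]
    exact h.choose_spec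
  have htn : ∀ y, ‖t y‖ ≤ ‖a‖ + 1 := by
    intro y
    by_cases h : ∃ b : A y, (⟨y, b⟩ : TotSpace A) ∈ W
    · exact (hW (ht y h)).2.le
    · simp only [t, dif_neg h]; simp; positivity
  obtain ⟨f, hf0, hf1, hf⟩ := exists_continuous_zero_one_of_isClosed (X := X) hU.isClosed_compl
    (isClosed_singleton (x := x)) (by
      rw [Set.disjoint_singleton_right, Set.mem_compl_iff, not_not]; exact ⟨_, hx, rfl⟩)
  have hfc : Continuous fun y ↦ ((f y : ℝ) : ℂ) := Complex.continuous_ofReal.comp f.continuous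
  obtain ⟨s, hs, hst⟩ := exists_contSection_near (A := A) (s := fun y ↦ ((f y : ℝ) : ℂ) • t y) hε
    (fun y ↦ by
      by_cases hy : y ∈ TotSpace.pt '' W
      · obtain ⟨⟨_, b⟩, hb, rfl⟩ := hy
        refine ⟨_, (IsNearAt.smul (a := b) (e := ε) (IsNearAt.of_lt ?_) hfc).mono ?_⟩
        · filter_upwards [hWo.mem_nhds hb]
          rintro ⟨y, q⟩ hq
          exact (h _ _ _ (hW hq).1.1 (hW (ht y ⟨q, hq⟩)).1.2).le
        · rw [Complex.norm_real, Real.norm_of_nonneg (hf _).1]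
          exact mul_le_of_le_one_left hε.le (hf _).2
      · refine ⟨_, (((isNearAt_zero y).of_norm_sub_le (t := t) (d := ‖a‖ + 1) fun z ↦ ?_).smul
          hfc).mono ?_⟩
        · simpa using htn z
        · have : f y = 0 := hf0 hy
          simp [this, hε.le])
  refine ⟨s, hs, ?_⟩
  have h3 := hst x
  have h4 : f x = 1 := hf1 rfl
  simp only [h4, Complex.ofReal_one, one_smul] at h3
  have h5 := h x a (t x) (hW hx).1.1 (hW (ht x ⟨a, hx⟩)).1.2
  have := norm_sub_le_norm_sub_add_norm_sub a (t x) (s x)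
  linarith

/-- There are enough continuous sections: each point of the total space lies on one. -/
theorem exists_contSection_eq [CompactSpace X] [T2Space X] {x : X} [FiniteDimensional ℂ (A x)]
    (a : A x) : ∃ s ∈ ContSections A, s x = a := by
  -- The values at `x` of continuous sections form a subspace, closed by finite dimension, whose
  -- closure contains `a`.
  let W : Submodule ℂ (A x) := (Subalgebra.toSubmodule (ContSections A).toSubalgebra).map
    (LinearMap.proj x)
  have hW : a ∈ closure (W : Set (A x)) := by
    rw [Metric.mem_closure_iff]
    intro ε hε
    obtain ⟨s, hs, h⟩ := exists_contSection_norm_sub_le a (ε := ε / 6) (by positivity)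
    exact ⟨s x, ⟨s, hs, rfl⟩, by rw [dist_eq_norm]; linarith⟩
  rw [IsClosed.closure_eq W.closed_of_finiteDimensional] at hW
  obtain ⟨s, hs, h⟩ := hW
  exact ⟨s, hs, h⟩

theorem continuous_norm_contSection {s : ∀ x, A x} (hs : s ∈ ContSections A) :
    Continuous fun y ↦ ‖s y‖ :=
  (IsUnitalFellBundle.continuous_norm (A := A)).comp (mem_contSections.1 hs)

/-- Continuous functional calculus of a self-adjoint continuous section. -/
theorem cfc_mem_contSections [CompactSpace X] {s : ∀ x, A x} (hs : s ∈ ContSections A)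
    (hsa : ∀ y, IsSelfAdjoint (s y)) {f : ℝ → ℝ} (hf : Continuous f) :
    (fun y ↦ cfc f (s y)) ∈ ContSections A := by
  obtain ⟨M, hM⟩ := (isCompact_range (continuous_norm_contSection hs)).bddAbove
  have hsp : ∀ y, ∀ r ∈ spectrum ℝ (s y), r ∈ Set.Icc (-M) M := by
    intro y r hr
    rcases subsingleton_or_nontrivial (A y) with h | h
    · simp at hr
    have := spectrum.norm_le_norm_of_mem hr
    rw [Real.norm_eq_abs, abs_le] at this
    have h2 : ‖s y‖ ≤ M := hM ⟨y, rfl⟩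
    constructor <;> linarith
  have hpoly : ∀ p : Polynomial ℝ, (fun y ↦ Polynomial.aeval (s y) p) ∈ ContSections A := by
    intro p
    induction p using Polynomial.induction_on' with
    | add p q hp hq =>
      simp only [map_add]
      exact add_mem hp hq
    | monomial n c =>
      have : (fun y ↦ Polynomial.aeval (s y) (Polynomial.monomial n c)) = (c : ℂ) • s ^ n := by
        ext y
        simp [Polynomial.aeval_monomial, Algebra.algebraMap_eq_smul_one]
      rw [this]
      exact SMulMemClass.smul_mem _ (pow_mem hs n)
  -- Weierstrass approximation on the interval `[-M, M]`, which contains the spectra in all fibres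
  -- at once.
  refine mem_contSections_of_uniform_limit fun e he ↦ ?_
  obtain ⟨p, hp⟩ := exists_polynomial_near_of_continuousOn (-M) M f hf.continuousOn e he
  refine ⟨_, hpoly p, fun y ↦ ?_⟩
  rw [← cfc_polynomial p (s y) (hsa y), ← cfc_sub _ _ (s y)]
  refine norm_cfc_le he.le fun r hr ↦ ?_
  exact (hp r (hsp y r hr)).le

end Bundle

/-! ### Minimal projections and tracial functionals -/

section MinimalProjections

set_option linter.unusedSectionVars false

variable {B : Type*} [Ring B] [StarRing B] [Algebra ℂ B]

theorem IsStarProjection.mul_self {p : B} (hp : IsStarProjection p) : p * p = p :=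
  hp.isIdempotentElem

theorem IsStarProjection.star_eq {p : B} (hp : IsStarProjection p) : star p = p :=
  hp.isSelfAdjoint

theorem IsStarProjection.mul_eq_of_mul_eq {p q : B} (hp : IsStarProjection p)
    (hq : IsStarProjection q) (h : q * p = q) : p * q = q := by
  have := congrArg star h
  rwa [star_mul, hp.star_eq, hq.star_eq] at this

/-- The state of a minimal projection `p`: the coefficient `c` in `p * b * p = c • p`. -/
noncomputable def IsMinimalProjection.coeff {p : B} (hp : IsMinimalProjection p) : B →ₗ[ℂ] ℂ where
  toFun b := (hp.2.2 b).choose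
  map_add' a b := smul_left_injective ℂ hp.2.1 <| by
    simp only [add_smul]
    rw [← (hp.2.2 a).choose_spec, ← (hp.2.2 b).choose_spec, ← (hp.2.2 (a + b)).choose_spec]
    noncomm_ring
  map_smul' c a := smul_left_injective ℂ hp.2.1 <| by
    simp only [smul_eq_mul, RingHom.id_apply, mul_smul]
    rw [← (hp.2.2 a).choose_spec, ← (hp.2.2 (c • a)).choose_spec]
    simp

theorem IsMinimalProjection.mul_mul {p : B} (hp : IsMinimalProjection p) (b : B) :
    p * b * p = hp.coeff b • p := (hp.2.2 b).choose_spec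

theorem IsMinimalProjection.coeff_eq {p : B} (hp : IsMinimalProjection p) {b : B} {c : ℂ}
    (h : p * b * p = c • p) : hp.coeff b = c :=
  smul_left_injective ℂ hp.2.1 (by simp only [← hp.mul_mul, h])

theorem IsMinimalProjection.coeff_self {p : B} (hp : IsMinimalProjection p) : hp.coeff p = 1 :=
  hp.coeff_eq (by rw [hp.1.mul_self, hp.1.mul_self, one_smul])

/-- With `x = p * a * q` and `y = q * b * p`, the products `x * y` and `y * x` are multiples of `p`
and `q`. Comparing `(x * y) * x` with `x * (y * x)` identifies the scalars. This symmetry is the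
source of the trace property. -/
theorem IsMinimalProjection.coeff_swap {p q : B} (hp : IsMinimalProjection p)
    (hq : IsMinimalProjection q) (a b : B) :
    hp.coeff (a * q * b) = hq.coeff (b * p * a) := by
  have e1 : (p * a * q) * (q * b * p) = hp.coeff (a * q * b) • p := by
    rw [← hp.mul_mul]
    calc _ = p * a * (q * q) * b * p := by noncomm_ring
      _ = _ := by rw [hq.1.mul_self]; noncomm_ring
  have e2 : (q * b * p) * (p * a * q) = hq.coeff (b * p * a) • q := by
    rw [← hq.mul_mul]
    calc _ = q * b * (p * p) * a * q := by noncomm_ring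
      _ = _ := by rw [hp.1.mul_self]; noncomm_ring
  by_cases h : p * a * q = 0
  · rw [h, zero_mul] at e1
    rw [h, mul_zero] at e2
    rw [(smul_eq_zero_iff_left hp.2.1).1 e1.symm, (smul_eq_zero_iff_left hq.2.1).1 e2.symm]
  · refine smul_left_injective ℂ h ?_
    simp only
    calc hp.coeff (a * q * b) • (p * a * q) = (hp.coeff (a * q * b) • p) * (p * a * q) := by
          rw [smul_mul_assoc, ← mul_assoc, ← mul_assoc, hp.1.mul_self]
      _ = (p * a * q) * (hq.coeff (b * p * a) • q) := by rw [← e1, ← e2, mul_assoc]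
      _ = _ := by rw [mul_smul_comm, mul_assoc (p * a), hq.1.mul_self]

/-- A tracial functional takes equal values on equivalent minimal projections. -/
theorem IsMinimalProjection.trace_eq {p q : B} (hp : IsMinimalProjection p)
    (hq : IsMinimalProjection q) (hB : ∀ x : B, star x * x = 0 → x = 0) {τ : B →ₗ[ℂ] ℂ}
    (hτ : ∀ a b, τ (a * b) = τ (b * a)) {b : B} (hb : p * b * q ≠ 0) : τ p = τ q := by
  set x := p * b * q with hx
  have hsx : star x = q * star b * p := by
    rw [hx, star_mul, star_mul, hp.1.star_eq, hq.1.star_eq, mul_assoc]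
  have e1 : x * star x = hp.coeff (b * q * star b) • p := by
    rw [← hp.mul_mul, hsx, hx]
    calc _ = p * b * (q * q) * star b * p := by noncomm_ring
      _ = _ := by rw [hq.1.mul_self]; noncomm_ring
  have e2 : star x * x = hp.coeff (b * q * star b) • q := by
    rw [hp.coeff_swap hq, ← hq.mul_mul, hsx, hx]
    calc _ = q * star b * (p * p) * b * q := by noncomm_ring
      _ = _ := by rw [hp.1.mul_self]; noncomm_ring
  have hc : hp.coeff (b * q * star b) ≠ 0 := by
    intro h
    rw [h, zero_smul] at e2
    exact hb (hB x e2)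
  have := hτ x (star x)
  rw [e1, e2, map_smul, map_smul, smul_eq_mul, smul_eq_mul] at this
  exact mul_left_cancel₀ hc this

/-- The canonical trace of a finite-dimensional `C^*`-algebra: the tracial functional that takes
the value one on all minimal projections. -/
structure IsCanonicalTrace (τ : B →ₗ[ℂ] ℂ) : Prop where
  map_mul_comm : ∀ a b, τ (a * b) = τ (b * a)
  map_minimal : ∀ p, IsMinimalProjection p → τ p = 1

theorem IsCanonicalTrace.eq_sum_coeff {τ : B →ₗ[ℂ] ℂ} (hτ : IsCanonicalTrace τ) {ι : Type*}
    [Fintype ι] {p : ι → B} (hp : ∀ i, IsMinimalProjection (p i)) (h1 : ∑ i, p i = 1) (a : B) :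
    τ a = ∑ i, (hp i).coeff a := by
  calc τ a = τ (∑ i, p i * a) := by rw [← Finset.sum_mul, h1, one_mul]
    _ = ∑ i, τ (p i * a) := map_sum _ _ _
    _ = _ := by
      refine Finset.sum_congr rfl fun i _ ↦ ?_
      calc τ (p i * a) = τ (p i * (p i * a)) := by rw [← mul_assoc, (hp i).1.mul_self]
        _ = τ (p i * a * p i) := hτ.map_mul_comm _ _
        _ = _ := by
          rw [(hp i).mul_mul, map_smul, hτ.map_minimal _ (hp i), smul_eq_mul, mul_one]

end MinimalProjections

/-! ### Finite-dimensional `C^*`-algebras: spectral projections and the canonical trace -/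

section FiniteDimensionalCStar

set_option linter.unusedSectionVars false

variable {B : Type*} [CStarAlgebra B] [FiniteDimensional ℂ B]

theorem eq_zero_of_star_mul_self {x : B} (h : star x * x = 0) : x = 0 :=
  CStarRing.star_mul_self_eq_zero_iff x |>.1 h

theorem finite_spectrum_real (a : B) : (spectrum ℝ a).Finite := by
  have : FiniteDimensional ℝ B := FiniteDimensional.complexToReal B
  have hne : minpoly ℝ a ≠ 0 := minpoly.ne_zero (Algebra.IsIntegral.isIntegral a)
  refine ((minpoly ℝ a).roots.toFinset.finite_toSet).subset fun r hr ↦ ?_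
  have h := spectrum.subset_polynomial_aeval a (minpoly ℝ a) ⟨r, hr, rfl⟩
  rw [minpoly.aeval] at h
  rcases subsingleton_or_nontrivial B with hB | hB
  · simp at hr
  rw [spectrum.zero_eq] at h
  simpa [hne] using h

/-- The spectrum is finite, so the indicator function of `{r}` is continuous on it and the
functional calculus applies. -/
theorem exists_spectral_projection {h : B} (hh : IsSelfAdjoint h) {r : ℝ} (hr : r ∈ spectrum ℝ h) :
    ∃ q : B, IsStarProjection q ∧ q ≠ 0 ∧ h * q = (r : ℂ) • q := by
  classical
  let f : ℝ → ℝ := fun t ↦ if t = r then 1 else 0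
  have hf : ContinuousOn f (spectrum ℝ h) := (finite_spectrum_real h).continuousOn f
  refine ⟨cfc f h, ⟨?_, cfc_predicate f h⟩, fun h0 ↦ ?_, ?_⟩
  · rw [IsIdempotentElem, ← cfc_mul f f h hf hf]
    refine cfc_congr fun t _ ↦ ?_
    by_cases ht : t = r <;> simp [f, ht]
  · have h1 : f r ∈ spectrum ℝ (cfc f h) := by
      rw [cfc_map_spectrum f h hh hf]; exact ⟨r, hr, rfl⟩
    rcases subsingleton_or_nontrivial B with hB | hB
    · simp at hr
    rw [h0, spectrum.zero_eq] at h1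
    simp [f] at h1
  · nth_rewrite 1 [← cfc_id ℝ h]
    rw [← cfc_mul id f h continuousOn_id hf]
    have : (r : ℂ) • cfc f h = r • cfc f h := by simp
    rw [this, ← cfc_smul r f h hf]
    refine cfc_congr fun t _ ↦ ?_
    by_cases ht : t = r <;> simp [f, ht]

theorem exists_ne_zero_mem_spectrum {h : B} (hh : IsSelfAdjoint h) (h0 : h ≠ 0) :
    ∃ r ∈ spectrum ℝ h, r ≠ 0 := by
  by_contra! H
  apply h0
  rw [← cfc_id ℝ h, ← cfc_zero ℝ h]
  exact cfc_congr fun t ht ↦ H t ht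

theorem finrank_range_mulLeft_lt {p q : B} (hp : IsStarProjection p) (hq : IsStarProjection q)
    (hqp : q * p = q) (hne : q ≠ p) :
    Module.finrank ℂ (LinearMap.range (LinearMap.mulLeft ℂ q)) <
      Module.finrank ℂ (LinearMap.range (LinearMap.mulLeft ℂ p)) := by
  have hpq := hp.mul_eq_of_mul_eq hq hqp
  refine Submodule.finrank_lt_finrank_of_lt (lt_of_le_of_ne ?_ fun h ↦ hne ?_)
  · rintro _ ⟨x, rfl⟩
    exact ⟨q * x, by simp [← mul_assoc, hpq]⟩
  · have h1 : p ∈ LinearMap.range (LinearMap.mulLeft ℂ q) := by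
      rw [h]; exact ⟨1, by simp⟩
    obtain ⟨y, hy⟩ := h1
    rw [LinearMap.mulLeft_apply] at hy
    rw [← hqp, ← hy, ← mul_assoc, hq.mul_self]

/-- Descent on the dimension of `p * B`. If `p` is not minimal, some self-adjoint `p * b * p` is not
a multiple of `p`, and its spectral projection at a nonzero eigenvalue lies strictly below `p`. -/
theorem exists_isMinimalProjection_le {p : B} (hp : IsStarProjection p) (hp0 : p ≠ 0) :
    ∃ q, IsMinimalProjection q ∧ q * p = q := by
  induction hn : Module.finrank ℂ (LinearMap.range (LinearMap.mulLeft ℂ p)) using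
    Nat.strong_induction_on generalizing p with
  | _ n ih =>
  by_cases hsa : ∀ b : B, IsSelfAdjoint b → ∃ c : ℂ, p * b * p = c • p
  · refine ⟨p, ⟨hp, hp0, fun b ↦ ?_⟩, hp.mul_self⟩
    obtain ⟨c, hc⟩ := hsa _ (realPart b).2
    obtain ⟨d, hd⟩ := hsa _ (imaginaryPart b).2
    refine ⟨c + Complex.I * d, ?_⟩
    conv_lhs => rw [← realPart_add_I_smul_imaginaryPart b]
    rw [mul_add, add_mul, mul_smul_comm, smul_mul_assoc, hc, hd, add_smul, mul_smul]
  · push Not at hsa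
    obtain ⟨b, hb, hbp⟩ := hsa
    have hh : IsSelfAdjoint (p * b * p) := by
      rw [IsSelfAdjoint, star_mul, star_mul, hp.star_eq, hb.star_eq, mul_assoc]
    obtain ⟨r, hr, hr0⟩ := exists_ne_zero_mem_spectrum hh (by simpa using hbp 0)
    obtain ⟨q, hq, hq0, hqr⟩ := exists_spectral_projection hh hr
    have hr0' : (r : ℂ) ≠ 0 := by exact_mod_cast hr0
    have hpq : p * q = q := by
      apply smul_right_injective B hr0'
      simp only
      rw [← mul_smul_comm, ← hqr]
      simp only [← mul_assoc, hp.mul_self]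
    have hqp : q * p = q := by
      have := congrArg star hpq
      rwa [star_mul, hp.star_eq, hq.star_eq] at this
    have hne : q ≠ p := by
      rintro rfl
      exact hbp r (by rw [← hqr, mul_assoc _ q q, hq.mul_self])
    obtain ⟨q', hq', hq'q⟩ := ih _ (hn ▸ finrank_range_mulLeft_lt hp hq hqp hne) hq hq0 rfl
    exact ⟨q', hq', by rw [← hq'q, mul_assoc, hqp]⟩

theorem exists_minimal_decomposition {p : B} (hp : IsStarProjection p) :
    ∃ S : Finset B, (∀ q ∈ S, IsMinimalProjection q) ∧
      (∀ q ∈ S, ∀ q' ∈ S, q ≠ q' → q * q' = 0) ∧ ∑ q ∈ S, q = p := by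
  classical
  induction hn : Module.finrank ℂ (LinearMap.range (LinearMap.mulLeft ℂ p)) using
    Nat.strong_induction_on generalizing p with
  | _ n ih =>
  by_cases hp0 : p = 0
  · exact ⟨∅, by simp, by simp, by simp [hp0]⟩
  obtain ⟨q, hq, hqp⟩ := exists_isMinimalProjection_le hp hp0
  have hpq := hp.mul_eq_of_mul_eq hq.1 hqp
  have hpr : IsStarProjection (p - q) := by
    refine ⟨?_, hp.isSelfAdjoint.sub hq.1.isSelfAdjoint⟩
    rw [IsIdempotentElem, mul_sub, sub_mul, sub_mul, hp.mul_self, hq.1.mul_self, hqp, hpq]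
    abel
  obtain ⟨S, hS, hS', hsum⟩ := ih _ (hn ▸ finrank_range_mulLeft_lt (q := p - q) hp hpr
    (by rw [sub_mul, hp.mul_self, hqp]) (by simpa using hq.2.1)) hpr rfl
  have key : ∀ s ∈ S, s * q = 0 := by
    intro s hs
    have h1 : s * (p - q) = s := by
      rw [← hsum, Finset.mul_sum, Finset.sum_eq_single_of_mem s hs, (hS s hs).1.mul_self]
      exact fun t ht hts ↦ hS' s hs t ht hts.symm
    rw [← h1, mul_assoc, sub_mul, hpq, hq.1.mul_self, sub_self, mul_zero]
  have key' : ∀ s ∈ S, q * s = 0 := by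
    intro s hs
    have := congrArg star (key s hs)
    rwa [star_mul, (hS s hs).1.star_eq, hq.1.star_eq, star_zero] at this
  have hqS : q ∉ S := fun h ↦ hq.2.1 (by rw [← hq.1.mul_self]; exact key q h)
  refine ⟨insert q S, ?_, ?_, ?_⟩
  · intro s hs
    rcases Finset.mem_insert.1 hs with rfl | hs
    exacts [hq, hS s hs]
  · intro s hs t ht hst
    rw [Finset.mem_insert] at hs ht
    rcases hs with rfl | hs <;> rcases ht with rfl | ht
    exacts [absurd rfl hst, key' t ht, key s hs, hS' s hs t ht hst]
  · rw [Finset.sum_insert hqS, hsum]; abel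

variable (B) in
/-- The unit is a finite sum of pairwise orthogonal minimal projections. -/
theorem exists_minimal_partition : ∃ (r : ℕ) (p : Fin r → B),
    (∀ i, IsMinimalProjection (p i)) ∧ (∀ i j, i ≠ j → p i * p j = 0) ∧ ∑ i, p i = 1 := by
  obtain ⟨S, hS, hS', h1⟩ := exists_minimal_decomposition (IsStarProjection.one (R := B))
  refine ⟨S.card, fun i ↦ (S.equivFin.symm i : B), fun i ↦ hS _ (Subtype.prop _),
    fun i j hij ↦ hS' _ (Subtype.prop _) _ (Subtype.prop _) ?_, ?_⟩
  · rw [Ne, Subtype.coe_inj, Equiv.apply_eq_iff_eq]; exact hij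
  · rw [Equiv.sum_comp S.equivFin.symm (fun q : S ↦ (q : B)), Finset.sum_coe_sort S fun q ↦ q, h1]

-- The trace is the sum of the states of a minimal partition of the unit. Inserting the partition
-- between two factors reduces the trace property to `coeff_swap`. A minimal `q` is not annihilated
-- by all the `p i`, so it is equivalent to one of them, where orthogonality makes the value one.
variable (B) in
theorem exists_isCanonicalTrace : ∃ τ : B →ₗ[ℂ] ℂ, IsCanonicalTrace τ := by
  obtain ⟨r, p, hp, horth, h1⟩ := exists_minimal_partition B
  have hcomm : ∀ a b, (∑ i, (hp i).coeff) (a * b) = (∑ i, (hp i).coeff) (b * a) := by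
    intro a b
    have e : ∀ c d : B, ∀ i, (hp i).coeff (c * d) = ∑ j, (hp i).coeff (c * p j * d) := by
      intro c d i
      rw [← map_sum, ← Finset.sum_mul, ← Finset.mul_sum, h1, mul_one]
    rw [LinearMap.sum_apply, LinearMap.sum_apply, Finset.sum_congr rfl fun i _ ↦ e a b i,
      Finset.sum_congr rfl fun i _ ↦ e b a i, Finset.sum_comm]
    exact Finset.sum_congr rfl fun i _ ↦ Finset.sum_congr rfl fun j _ ↦ (hp j).coeff_swap (hp i) _ _
  refine ⟨∑ i, (hp i).coeff, hcomm, fun q hq ↦ ?_⟩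
  obtain ⟨i, hi⟩ : ∃ i, p i * 1 * q ≠ 0 := by
    by_contra! H
    apply hq.2.1
    rw [← one_mul q, ← h1, Finset.sum_mul]
    exact Finset.sum_eq_zero fun i _ ↦ by simpa using H i
  rw [← (hp i).trace_eq hq (fun x ↦ eq_zero_of_star_mul_self) hcomm hi, LinearMap.sum_apply,
    Finset.sum_eq_single i, (hp i).coeff_self]
  · intro j _ hj
    exact (hp j).coeff_eq (by rw [horth j i hj, zero_mul, zero_smul])
  · simp

theorem IsMinimalProjection.norm_eq {p : B} (hp : IsMinimalProjection p) : ‖p‖ = 1 := by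
  have h := CStarRing.norm_star_mul_self (x := p)
  rw [hp.1.star_eq, hp.1.mul_self] at h
  have : ‖p‖ ≠ 0 := norm_ne_zero_iff.2 hp.2.1
  exact (mul_right_cancel₀ this (by rw [one_mul]; exact h)).symm

theorem IsMinimalProjection.norm_coeff_le {p : B} (hp : IsMinimalProjection p) (a : B) :
    ‖hp.coeff a‖ ≤ ‖a‖ := by
  have h : ‖p * a * p‖ = ‖hp.coeff a‖ := by rw [hp.mul_mul, norm_smul, hp.norm_eq, mul_one]
  rw [← h]
  refine (norm_mul₃_le).trans ?_
  rw [hp.norm_eq, one_mul, mul_one]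

/-- The scalar is real by self-adjointness, and it lies in the spectrum of `star x * x` because `p`
is a nonzero eigenprojection. -/
theorem exists_nonneg_of_star_mul_self_eq_smul {p x : B} (hp : IsStarProjection p) (hp0 : p ≠ 0)
    {c : ℂ} (h : star x * x = c • p) : ∃ r : ℝ, 0 ≤ r ∧ c = r := by
  have h1 : star c = c := by
    have := congrArg star h
    rw [star_mul, star_star, star_smul, hp.star_eq, h] at this
    exact (smul_left_injective ℂ hp0 this).symm
  obtain ⟨r, rfl⟩ := Complex.conj_eq_iff_real.1 h1
  refine ⟨r, ?_, rfl⟩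
  refine spectrum_star_mul_self_nonneg (b := x) r ?_
  rw [spectrum.mem_iff, h]
  rintro ⟨u, hu⟩
  apply hp0
  have h2 : (u : B) * p = 0 := by
    rw [hu, sub_mul, smul_mul_assoc, hp.mul_self, Algebra.algebraMap_eq_smul_one, smul_mul_assoc,
      one_mul]
    simp
  simpa using h2

theorem IsMinimalProjection.coeff_star_mul_self {p : B} (hp : IsMinimalProjection p) (a : B) :
    ∃ r : ℝ, 0 ≤ r ∧ hp.coeff (star a * a) = r := by
  refine exists_nonneg_of_star_mul_self_eq_smul hp.1 hp.2.1 (x := a * p) ?_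
  rw [← hp.mul_mul, star_mul, hp.1.star_eq]
  noncomm_ring

theorem IsCanonicalTrace.star_mul_self {τ : B →ₗ[ℂ] ℂ} (hτ : IsCanonicalTrace τ) (a : B) :
    ∃ r : ℝ, 0 ≤ r ∧ τ (star a * a) = r := by
  obtain ⟨n, p, hp, -, h1⟩ := exists_minimal_partition B
  choose r hr hrc using fun i ↦ (hp i).coeff_star_mul_self a
  refine ⟨∑ i, r i, Finset.sum_nonneg fun i _ ↦ hr i, ?_⟩
  rw [hτ.eq_sum_coeff hp h1]
  simp [hrc]

/-- The rank of a partition of the unit into minimal projections is the trace of the unit. -/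
theorem IsCanonicalTrace.one_eq_card {τ : B →ₗ[ℂ] ℂ} (hτ : IsCanonicalTrace τ) {ι : Type*}
    [Fintype ι] {p : ι → B} (hp : ∀ i, IsMinimalProjection (p i)) (h1 : ∑ i, p i = 1) :
    τ 1 = Fintype.card ι := by
  rw [← h1, map_sum, Finset.sum_congr rfl fun i _ ↦ hτ.map_minimal _ (hp i)]
  simp

theorem IsCanonicalTrace.norm_le {τ : B →ₗ[ℂ] ℂ} (hτ : IsCanonicalTrace τ) {ι : Type*}
    [Fintype ι] {p : ι → B} (hp : ∀ i, IsMinimalProjection (p i)) (h1 : ∑ i, p i = 1) (a : B) :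
    ‖τ a‖ ≤ Fintype.card ι * ‖a‖ := by
  rw [hτ.eq_sum_coeff hp h1]
  refine (norm_sum_le _ _).trans ((Finset.sum_le_sum fun i _ ↦ (hp i).norm_coeff_le a).trans ?_)
  simp

theorem IsCanonicalTrace.one_le_of_projection {τ : B →ₗ[ℂ] ℂ} (hτ : IsCanonicalTrace τ) {q : B}
    (hq : IsStarProjection q) (hq0 : q ≠ 0) : ∃ n : ℕ, 1 ≤ n ∧ τ q = n := by
  obtain ⟨S, hS, -, hsum⟩ := exists_minimal_decomposition hq
  refine ⟨S.card, ?_, ?_⟩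
  · rw [Nat.one_le_iff_ne_zero, Ne, Finset.card_eq_zero]
    rintro rfl
    exact hq0 (by simpa using hsum.symm)
  · rw [← hsum, map_sum, Finset.sum_congr rfl fun i hi ↦ hτ.map_minimal _ (hS i hi)]
    simp

/-- The canonical trace dominates the spectrum of a positive element. -/
theorem IsCanonicalTrace.spectrum_le {τ : B →ₗ[ℂ] ℂ} (hτ : IsCanonicalTrace τ) (a : B) :
    ∀ r ∈ spectrum ℝ (star a * a), r ≤ (τ (star a * a)).re := by
  intro r hr
  have hr0 := spectrum_star_mul_self_nonneg r hr
  obtain ⟨q, hq, hq0, hqr⟩ := exists_spectral_projection (IsSelfAdjoint.star_mul_self a) hr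
  obtain ⟨n, hn, hqn⟩ := hτ.one_le_of_projection hq hq0
  obtain ⟨t, ht, htr⟩ := hτ.star_mul_self (a * (1 - q))
  -- Removing the eigenspace of `r` leaves a positive element and lowers the trace by `r * n`, where
  -- `n ≥ 1`.
  have e : τ (star (a * (1 - q)) * (a * (1 - q))) = τ (star a * a) - r * n := by
    have e1 : star (a * (1 - q)) * (a * (1 - q)) = (1 - q) * (star a * a * (1 - q)) := by
      rw [star_mul, star_sub, star_one, hq.star_eq]; noncomm_ring
    rw [e1, hτ.map_mul_comm, mul_assoc]
    have e2 : (1 - q) * (1 - q) = 1 - q := by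
      rw [mul_sub, sub_mul, sub_mul, hq.mul_self]; simp
    rw [e2, mul_sub, mul_one, hqr, map_sub, map_smul, hqn, smul_eq_mul]
  rw [e] at htr
  have h3 := congrArg Complex.re htr
  simp at h3
  have : (1 : ℝ) ≤ n := by exact_mod_cast hn
  nlinarith

end FiniteDimensionalCStar

/-! ### Irreducible representations and the rank -/

section Irreps

variable {B : Type*} [Ring B] [StarRing B] [Algebra ℂ B]

open Matrix
open scoped ComplexOrder

theorem Irrep.exists_mulVec_eq (π : Irrep B) {v : Fin π.dim → ℂ} (hv : v ≠ 0)
    (z : Fin π.dim → ℂ) : ∃ a, π.hom a *ᵥ v = z := by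
  let W : Submodule ℂ (Fin π.dim → ℂ) :=
    { carrier := {z | ∃ a, π.hom a *ᵥ v = z}
      add_mem' := by
        rintro _ _ ⟨a, rfl⟩ ⟨b, rfl⟩
        exact ⟨a + b, by rw [map_add, add_mulVec]⟩
      zero_mem' := ⟨0, by simp⟩
      smul_mem' := by
        rintro c _ ⟨a, rfl⟩
        exact ⟨c • a, by rw [map_smul, smul_mulVec]⟩ }
  have hW := π.irreducible W (by
    rintro b _ ⟨a, rfl⟩
    exact ⟨b * a, by rw [map_mul, mulVec_mulVec]⟩)
  have hvW : v ∈ W := ⟨1, by simp⟩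
  have : z ∈ W := by
    rcases hW with hW | hW
    · rw [hW] at hvW; exact absurd hvW hv
    · rw [hW]; trivial
  exact this

theorem Irrep.exists_unit_vector (π : Irrep B) {p : B} (hp : IsStarProjection p)
    (h : π.hom p ≠ 0) : ∃ v : Fin π.dim → ℂ, π.hom p *ᵥ v = v ∧ star v ⬝ᵥ v = 1 := by
  obtain ⟨z, hz⟩ : ∃ z, π.hom p *ᵥ z ≠ 0 := by
    by_contra! H
    exact h (Matrix.toLin'.injective (LinearMap.ext fun z ↦ by simpa using H z))
  set w := π.hom p *ᵥ z with hw
  have hpw : π.hom p *ᵥ w = w := by rw [hw, mulVec_mulVec, ← map_mul, hp.mul_self]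
  have hnorm : star w ⬝ᵥ w = ((∑ i, ‖w i‖ ^ 2 : ℝ) : ℂ) := by
    simp [dotProduct, ← Complex.conj_mul']
  have hpos : 0 < ∑ i, ‖w i‖ ^ 2 := by
    obtain ⟨i, hi⟩ := Function.ne_iff.1 hz
    exact Finset.sum_pos' (fun i _ ↦ by positivity) ⟨i, Finset.mem_univ _, by
      have : 0 < ‖w i‖ := norm_pos_iff.2 hi
      positivity⟩
  set S := ∑ i, ‖w i‖ ^ 2
  refine ⟨((√S)⁻¹ : ℂ) • w, by rw [mulVec_smul, hpw], ?_⟩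
  rw [star_smul, smul_dotProduct, dotProduct_smul, hnorm, smul_eq_mul, smul_eq_mul]
  have h1 : star ((√S : ℂ)⁻¹) = (√S : ℂ)⁻¹ := by simp
  have h2 : (√S : ℂ) * √S = S := by exact_mod_cast Real.mul_self_sqrt hpos.le
  have h3 : (√S : ℂ) ≠ 0 := by
    have := Real.sqrt_pos.2 hpos
    exact_mod_cast this.ne'
  rw [h1, ← h2]
  field_simp

/-- The vector state of a unit vector fixed by `p` is the state of `p`, so inner products along its
orbit do not depend on the representation. -/
theorem Irrep.dotProduct_eq_coeff (π : Irrep B) {p : B} (hp : IsMinimalProjection p)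
    {v : Fin π.dim → ℂ} (hv : π.hom p *ᵥ v = v) (hv1 : star v ⬝ᵥ v = 1) (a b : B) :
    star (π.hom a *ᵥ v) ⬝ᵥ (π.hom b *ᵥ v) = hp.coeff (star a * b) := by
  have e : ∀ x z, star (π.hom x *ᵥ v) ⬝ᵥ z = star v ⬝ᵥ (π.hom (star x) *ᵥ z) := by
    intro x z
    rw [star_mulVec, map_star, star_eq_conjTranspose, dotProduct_mulVec]
  rw [e, mulVec_mulVec, ← map_mul]
  have h2 : π.hom (p * (star a * b) * p) *ᵥ v = hp.coeff (star a * b) • v := by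
    rw [hp.mul_mul, map_smul, smul_mulVec, hv]
  rw [map_mul, map_mul, ← mulVec_mulVec, hv, ← mulVec_mulVec] at h2
  have h3 := e p (π.hom (star a * b) *ᵥ v)
  rw [hp.1.star_eq, hv] at h3
  rw [h3, h2, dotProduct_smul, hv1, smul_eq_mul, mul_one]

/-- The image of `p` is the rank-one projection onto its fixed unit vector `v`: vectors of the orbit
of `v` exhaust the space, and `p * a * p` acts on `v` as a scalar. -/
theorem Irrep.trace_eq_one (π : Irrep B) {p : B} (hp : IsMinimalProjection p)
    (h : π.hom p ≠ 0) : (π.hom p).trace = 1 := by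
  obtain ⟨v, hv, hv1⟩ := π.exists_unit_vector hp.1 h
  have hv0 : v ≠ 0 := by rintro rfl; simp at hv1
  have key : π.hom p = vecMulVec v (star v) := by
    refine Matrix.toLin'.injective (LinearMap.ext fun z ↦ ?_)
    obtain ⟨a, rfl⟩ := π.exists_mulVec_eq hv0 z
    have h1 := π.dotProduct_eq_coeff hp hv hv1 1 a
    rw [map_one, one_mulVec, star_one, one_mul] at h1
    have h2 : π.hom (p * a * p) *ᵥ v = hp.coeff a • v := by
      rw [hp.mul_mul, map_smul, smul_mulVec, hv]
    rw [map_mul, map_mul, ← mulVec_mulVec, hv, ← mulVec_mulVec] at h2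
    rw [toLin'_apply, toLin'_apply, h2, vecMulVec_mulVec, h1]
    ext i; simp [mul_comm]
  rw [key, trace_vecMulVec, dotProduct_comm, hv1]

/-- Uniqueness in the GNS construction: both representations contain a cyclic unit vector with the
state of `p`, so `π.hom b *ᵥ v ↦ σ.hom b *ᵥ w` is a well-defined unitary intertwiner. -/
theorem Irrep.equiv_of_ne_zero {π σ : Irrep B} {p : B} (hp : IsMinimalProjection p)
    (hπ : π.hom p ≠ 0) (hσ : σ.hom p ≠ 0) : π ≈ σ := by
  obtain ⟨v, hv, hv1⟩ := π.exists_unit_vector hp.1 hπ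
  obtain ⟨w, hw, hw1⟩ := σ.exists_unit_vector hp.1 hσ
  have hv0 : v ≠ 0 := by rintro rfl; simp at hv1
  have hw0 : w ≠ 0 := by rintro rfl; simp at hw1
  choose a ha using fun j ↦ π.exists_mulVec_eq hv0 (Pi.single j 1)
  have wd : ∀ b c, π.hom b *ᵥ v = π.hom c *ᵥ v → σ.hom b *ᵥ w = σ.hom c *ᵥ w := by
    intro b c h
    have h1 : π.hom (b - c) *ᵥ v = 0 := by rw [map_sub, sub_mulVec, h, sub_self]
    have h2 := π.dotProduct_eq_coeff hp hv hv1 (b - c) (b - c)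
    rw [h1, dotProduct_zero, ← σ.dotProduct_eq_coeff hp hw hw1, eq_comm,
      dotProduct_star_self_eq_zero] at h2
    rwa [map_sub, sub_mulVec, sub_eq_zero] at h2
  let u : Matrix (Fin σ.dim) (Fin π.dim) ℂ := Matrix.of fun i j ↦ (σ.hom (a j) *ᵥ w) i
  have hu : ∀ b, u *ᵥ (π.hom b *ᵥ v) = σ.hom b *ᵥ w := by
    intro b
    set z := π.hom b *ᵥ v with hz
    have h1 : u *ᵥ z = σ.hom (∑ j, z j • a j) *ᵥ w := by
      ext i
      simp only [map_sum, map_smul, sum_mulVec, smul_mulVec, Finset.sum_apply, Pi.smul_apply,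
        smul_eq_mul]
      simp [u, mulVec, dotProduct, mul_comm]
    rw [h1]
    refine wd _ _ ?_
    simp only [map_sum, map_smul, sum_mulVec, smul_mulVec, ha, ← hz]
    ext i
    simp [Finset.sum_apply, Pi.single_apply]
  have huu : uᴴ * u = 1 := by
    ext i j
    have h1 := σ.dotProduct_eq_coeff hp hw hw1 (a i) (a j)
    rw [← π.dotProduct_eq_coeff hp hv hv1, ha, ha] at h1
    have h2 : (uᴴ * u) i j = star (σ.hom (a i) *ᵥ w) ⬝ᵥ (σ.hom (a j) *ᵥ w) := by
      simp [Matrix.mul_apply, u, dotProduct]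
    rw [h2, h1]
    simp [Matrix.one_apply, Pi.single_apply, dotProduct, eq_comm]
  refine ⟨u, huu, ?_, fun b ↦ ?_⟩
  · refine Matrix.toLin'.injective (LinearMap.ext fun z ↦ ?_)
    obtain ⟨b, rfl⟩ := σ.exists_mulVec_eq hw0 z
    rw [← hu, toLin'_apply, mulVec_mulVec, Matrix.mul_assoc, huu]
    simp
  · refine Matrix.toLin'.injective (LinearMap.ext fun z ↦ ?_)
    obtain ⟨c, rfl⟩ := π.exists_mulVec_eq hv0 z
    rw [toLin'_apply, toLin'_apply, ← mulVec_mulVec, ← mulVec_mulVec, hu,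
      mulVec_mulVec v (π.hom b), ← map_mul, hu, mulVec_mulVec, ← map_mul]

theorem Irrep.ne_zero_of_equiv {π σ : Irrep B} (h : π ≈ σ) {b : B} (hb : π.hom b ≠ 0) :
    σ.hom b ≠ 0 := by
  obtain ⟨u, h1, -, hu⟩ := h
  intro h0
  apply hb
  rw [← Matrix.one_mul (π.hom b), ← h1, Matrix.mul_assoc, hu, h0, Matrix.zero_mul, Matrix.mul_zero]

/-- The rank is the number of terms in a partition of the unit into minimal projections, provided
that none of these is annihilated by all irreducible representations. -/
theorem algRank_eq_card {ι : Type*} [Fintype ι] {p : ι → B}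
    (hp : ∀ i, IsMinimalProjection (p i)) (h1 : ∑ i, p i = 1)
    (hirr : ∀ i, ∃ π : Irrep B, π.hom (p i) ≠ 0) : algRank B = Fintype.card ι := by
  classical
  choose π hπ using hirr
  let cls : ι → Quotient (Irrep.setoid B) := fun i ↦ Quotient.mk _ (π i)
  -- The dimension is the trace of the unit, to which each `p i` contributes one or zero according
  -- to whether the class is that of `π i`. Summed over the classes, each `i` is counted once.
  have hdim : ∀ c, Irrep.classDim B c = ∑ i, if c = cls i then 1 else 0 := by
    intro c
    induction c using Quotient.inductionOn with
    | _ σ =>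
    change σ.dim = _
    have h2 : ∀ i, (σ.hom (p i)).trace = if Quotient.mk _ σ = cls i then 1 else 0 := by
      intro i
      by_cases h : σ.hom (p i) = 0
      · rw [if_neg, h, trace_zero]
        intro hc
        exact Irrep.ne_zero_of_equiv (Quotient.exact hc.symm) (hπ i) h
      · rw [if_pos (Quotient.sound (Irrep.equiv_of_ne_zero (hp i) h (hπ i))),
          σ.trace_eq_one (hp i) h]
    have h3 : (σ.hom 1).trace = σ.dim := by simp
    rw [← h1, map_sum, trace_sum, Finset.sum_congr rfl fun i _ ↦ h2 i] at h3
    exact_mod_cast h3.symm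
  rw [algRank]
  simp_rw [hdim]
  push_cast
  rw [Summable.tsum_finsetSum fun i _ ↦ ENNReal.summable]
  simp

end Irreps

/-! ### Matrix units and embeddings of multi-matrix algebras -/

section MatrixUnits

set_option linter.unusedSectionVars false

variable {B : Type*} [Ring B] [StarRing B] [Algebra ℂ B]

/-- Systems of partial isometries that generate a system of matrix units of a multi-matrix
algebra: the matrix units are the products `v ⟨j, a⟩ * star (v ⟨j, b⟩)`. -/
structure IsMatrixSystem {k : ℕ} (m : Fin k → ℕ) (v : (Σ j, Fin (m j)) → B) (p : Fin k → B) :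
    Prop where
  star_mul_self : ∀ s, star (v s) * v s = p s.1
  star_mul_of_ne : ∀ s t, s ≠ t → star (v s) * v t = 0
  mul_init : ∀ s, v s * p s.1 = v s
  sum_eq_one : ∑ s, v s * star (v s) = 1
  ne_zero : ∀ j, p j ≠ 0

namespace IsMatrixSystem

variable {k : ℕ} {m : Fin k → ℕ} {v : (Σ j, Fin (m j)) → B} {p : Fin k → B}

theorem star_init (h : IsMatrixSystem m v p) (s : Σ j, Fin (m j)) : star (p s.1) = p s.1 := by
  rw [← h.star_mul_self, star_mul, star_star]

theorem init_mul_star (h : IsMatrixSystem m v p) (s : Σ j, Fin (m j)) : p s.1 * star (v s) = star (v s) := by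
  have := congrArg star (h.mul_init s)
  rwa [star_mul, h.star_init] at this

variable [StarModule ℂ B]

/-- The element of the algebra with prescribed coefficients with respect to the matrix units. -/
noncomputable def toFun (v : (Σ j, Fin (m j)) → B) (M : MultiMatrix m) : B :=
  ∑ j, ∑ a, ∑ b, M j a b • (v ⟨j, a⟩ * star (v ⟨j, b⟩))

theorem star_mul_toFun (h : IsMatrixSystem m v p) (M : MultiMatrix m) (j) (a : Fin (m j)) :
    star (v ⟨j, a⟩) * toFun v M = ∑ b, M j a b • star (v ⟨j, b⟩) := by
  classical
  rw [toFun, Finset.mul_sum, Finset.sum_eq_single_of_mem j (Finset.mem_univ _), Finset.mul_sum,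
    Finset.sum_eq_single_of_mem a (Finset.mem_univ _), Finset.mul_sum]
  · refine Finset.sum_congr rfl fun b _ ↦ ?_
    rw [mul_smul_comm, ← mul_assoc, h.star_mul_self, h.init_mul_star ⟨j, b⟩]
  · intro a' _ ha'
    rw [Finset.mul_sum]
    refine Finset.sum_eq_zero fun b _ ↦ ?_
    rw [mul_smul_comm, ← mul_assoc, h.star_mul_of_ne, zero_mul, smul_zero]
    simpa using ha'.symm
  · intro j' _ hj'
    rw [Finset.mul_sum]
    refine Finset.sum_eq_zero fun a' _ ↦ ?_
    rw [Finset.mul_sum]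
    refine Finset.sum_eq_zero fun b _ ↦ ?_
    rw [mul_smul_comm, ← mul_assoc, h.star_mul_of_ne, zero_mul, smul_zero]
    rintro ⟨⟩
    exact hj' rfl

theorem star_mul_toFun_mul (h : IsMatrixSystem m v p) (M : MultiMatrix m) (j) (a b : Fin (m j)) :
    star (v ⟨j, a⟩) * toFun v M * v ⟨j, b⟩ = M j a b • p j := by
  rw [h.star_mul_toFun, Finset.sum_mul, Finset.sum_eq_single_of_mem b (Finset.mem_univ _),
    smul_mul_assoc, h.star_mul_self]
  intro b' _ hb'
  rw [smul_mul_assoc, h.star_mul_of_ne, smul_zero]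
  simpa using hb'

/-- The embedding of a multi-matrix algebra defined by a system of matrix units. -/
noncomputable def hom (h : IsMatrixSystem m v p) : MultiMatrix m →⋆ₐ[ℂ] B where
  toFun := toFun v
  map_one' := by
    rw [← h.sum_eq_one, Fintype.sum_sigma, toFun]
    simp [Matrix.one_apply, ite_smul]
  map_mul' M N := by
    have e : ∀ j a, ∑ b, (M * N) j a b • (v ⟨j, a⟩ * star (v ⟨j, b⟩))
        = ∑ b, M j a b • (v ⟨j, a⟩ * star (v ⟨j, b⟩)) * toFun v N := by
      intro j a
      simp only [smul_mul_assoc, mul_assoc, h.star_mul_toFun, Finset.mul_sum, Finset.smul_sum,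
        mul_smul_comm, smul_smul]
      rw [Finset.sum_comm]
      simp [Matrix.mul_apply, Finset.sum_smul]
    rw [toFun, Finset.sum_congr rfl fun j _ ↦ Finset.sum_congr rfl fun a _ ↦ e j a]
    conv_rhs => rw [toFun, Finset.sum_mul]
    refine Finset.sum_congr rfl fun j _ ↦ ?_
    rw [Finset.sum_mul]
    refine Finset.sum_congr rfl fun a _ ↦ ?_
    rw [Finset.sum_mul]
  map_zero' := by simp [toFun]
  map_add' M N := by simp [toFun, add_smul, Finset.sum_add_distrib]
  commutes' c := by
    have e : ∀ j (a b : Fin (m j)), algebraMap ℂ (MultiMatrix m) c j a b = if a = b then c else 0 := by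
      intro j a b
      rw [Pi.algebraMap_apply, Matrix.algebraMap_matrix_apply]
      simp
    rw [Algebra.algebraMap_eq_smul_one (A := B), ← h.sum_eq_one, Fintype.sum_sigma, toFun,
      Finset.smul_sum]
    refine Finset.sum_congr rfl fun j _ ↦ ?_
    rw [Finset.smul_sum]
    refine Finset.sum_congr rfl fun a _ ↦ ?_
    rw [Finset.sum_eq_single_of_mem a (Finset.mem_univ _), e, if_pos rfl]
    intro b _ hb
    rw [e, if_neg hb.symm, zero_smul]
  map_star' M := by
    rw [toFun, toFun, star_sum]
    refine Finset.sum_congr rfl fun j _ ↦ ?_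
    rw [star_sum, Finset.sum_comm]
    refine Finset.sum_congr rfl fun a _ ↦ ?_
    rw [star_sum]
    refine Finset.sum_congr rfl fun b _ ↦ ?_
    rw [star_smul, star_mul, star_star, Pi.star_apply, Matrix.star_apply]

theorem hom_apply (h : IsMatrixSystem m v p) (M : MultiMatrix m) :
    h.hom M = ∑ j, ∑ a, ∑ b, M j a b • (v ⟨j, a⟩ * star (v ⟨j, b⟩)) := rfl

theorem hom_injective (h : IsMatrixSystem m v p) : Function.Injective h.hom := by
  rw [injective_iff_map_eq_zero]
  intro M hM
  ext j a b
  have := h.star_mul_toFun_mul M j a b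
  rw [show toFun v M = 0 from hM, mul_zero, zero_mul] at this
  simpa [h.ne_zero j] using this.symm

theorem hom_single (h : IsMatrixSystem m v p) (j) (a : Fin (m j)) :
    h.hom (Pi.single j (Matrix.single a a 1)) = v ⟨j, a⟩ * star (v ⟨j, a⟩) := by
  classical
  rw [hom_apply, Finset.sum_eq_single_of_mem j (Finset.mem_univ _),
    Finset.sum_eq_single_of_mem a (Finset.mem_univ _),
    Finset.sum_eq_single_of_mem a (Finset.mem_univ _)]
  · simp
  · intro b _ hb; simp [hb.symm]
  · intro b _ hb; simp [hb.symm]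
  · intro j' _ hj; simp [hj]

/-- Expand `x` by the partition of the unit on both sides. An entry `star (v s) * x * v t` lies in
the corner of `p j`, which is one-dimensional by minimality, when `s` and `t` share the block `j`;
otherwise it vanishes by `hb`. -/
theorem hom_surjective (h : IsMatrixSystem m v p) (hp : ∀ j, IsMinimalProjection (p j))
    (hb : ∀ s t, s.1 ≠ t.1 → ∀ x, star (v s) * x * v t = 0) : Function.Surjective h.hom := by
  intro x
  have hc : ∀ j (a b : Fin (m j)), ∃ c : ℂ, star (v ⟨j, a⟩) * x * v ⟨j, b⟩ = c • p j := by
    intro j a b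
    refine ⟨(hp j).coeff (star (v ⟨j, a⟩) * x * v ⟨j, b⟩), ?_⟩
    rw [← (hp j).mul_mul]
    have e1 := h.init_mul_star ⟨j, a⟩
    have e2 := h.mul_init ⟨j, b⟩
    simp only at e1 e2
    rw [← mul_assoc, ← mul_assoc, e1, mul_assoc _ _ (p j), e2]
  choose c hc using hc
  refine ⟨fun j ↦ Matrix.of (c j), ?_⟩
  symm
  calc x = (∑ s, v s * star (v s)) * x * (∑ t, v t * star (v t)) := by
        rw [h.sum_eq_one, one_mul, mul_one]
    _ = ∑ s, ∑ t, v s * (star (v s) * x * v t) * star (v t) := by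
        rw [Finset.sum_mul, Finset.sum_mul]
        refine Finset.sum_congr rfl fun s _ ↦ ?_
        rw [Finset.mul_sum]
        refine Finset.sum_congr rfl fun t _ ↦ ?_
        noncomm_ring
    _ = ∑ j, ∑ a, ∑ b, v ⟨j, a⟩ * (star (v ⟨j, a⟩) * x * v ⟨j, b⟩) * star (v ⟨j, b⟩) := by
        rw [Fintype.sum_sigma]
        refine Finset.sum_congr rfl fun j _ ↦ Finset.sum_congr rfl fun a _ ↦ ?_
        rw [Fintype.sum_sigma, Finset.sum_eq_single_of_mem j (Finset.mem_univ _)]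
        intro j' _ hj
        refine Finset.sum_eq_zero fun b _ ↦ ?_
        rw [hb _ _ (by simpa using hj.symm), mul_zero, zero_mul]
    _ = _ := by
        rw [hom_apply]
        refine Finset.sum_congr rfl fun j _ ↦ Finset.sum_congr rfl fun a _ ↦
          Finset.sum_congr rfl fun b _ ↦ ?_
        rw [hc, mul_smul_comm, smul_mul_assoc]
        have e2 := h.mul_init ⟨j, a⟩
        simp only at e2
        rw [e2]; rfl

end IsMatrixSystem

end MatrixUnits

/-! ### Structure of finite-dimensional `C^*`-algebras -/

section Structure

set_option linter.unusedSectionVars false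

variable (B : Type*) [CStarAlgebra B] [FiniteDimensional ℂ B]

-- The partial isometry is `p * b * q` divided by `√r`, where `r > 0` is the scalar for which `star
-- x * x = r • q`, with `x = p * b * q`.
variable {B} in
theorem IsMinimalProjection.exists_partial_isometry {p q b : B} (hp : IsMinimalProjection p)
    (hq : IsMinimalProjection q) (hb : p * b * q ≠ 0) :
    ∃ w, star w * w = q ∧ w * star w = p ∧ p * w = w ∧ w * q = w := by
  set x := p * b * q with hx
  have hsx : star x = q * star b * p := by
    rw [hx, star_mul, star_mul, hp.1.star_eq, hq.1.star_eq, mul_assoc]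
  have e1 : x * star x = hp.coeff (b * q * star b) • p := by
    rw [← hp.mul_mul, hsx, hx]
    calc _ = p * b * (q * q) * star b * p := by noncomm_ring
      _ = _ := by rw [hq.1.mul_self]; noncomm_ring
  have e2 : star x * x = hp.coeff (b * q * star b) • q := by
    rw [hp.coeff_swap hq, ← hq.mul_mul, hsx, hx]
    calc _ = q * star b * (p * p) * b * q := by noncomm_ring
      _ = _ := by rw [hp.1.mul_self]; noncomm_ring
  obtain ⟨r, hr, hc⟩ := exists_nonneg_of_star_mul_self_eq_smul hq.1 hq.2.1 e2
  rw [hc] at e1 e2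
  have hr0 : r ≠ 0 := by
    rintro rfl
    exact hb (eq_zero_of_star_mul_self (by simpa using e2))
  have h3 : (√r : ℂ) ≠ 0 := by
    have := Real.sqrt_pos.2 (lt_of_le_of_ne hr hr0.symm)
    exact_mod_cast this.ne'
  have h2 : (√r : ℂ) * √r = r := by exact_mod_cast Real.mul_self_sqrt hr
  have h4 : star ((√r : ℂ)⁻¹) = (√r : ℂ)⁻¹ := by simp
  have h5 : (√r : ℂ)⁻¹ * (√r : ℂ)⁻¹ * r = 1 := by rw [← h2]; field_simp
  refine ⟨(√r : ℂ)⁻¹ • x, ?_, ?_, ?_, ?_⟩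
  · rw [star_smul, h4, smul_mul_assoc, mul_smul_comm, e2, smul_smul, smul_smul, h5, one_smul]
  · rw [star_smul, h4, smul_mul_assoc, mul_smul_comm, e1, smul_smul, smul_smul, h5, one_smul]
  · rw [mul_smul_comm, hx, ← mul_assoc, ← mul_assoc, hp.1.mul_self]
  · rw [smul_mul_assoc, hx, mul_assoc, hq.1.mul_self]

/-- A finite-dimensional `C^*`-algebra has a full system of matrix units. -/
theorem exists_isMatrixSystem : ∃ (k : ℕ) (m : Fin k → ℕ) (v : (Σ j, Fin (m j)) → B)
    (p : Fin k → B), (∀ j, 0 < m j) ∧ IsMatrixSystem m v p ∧ (∀ j, IsMinimalProjection (p j)) ∧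
      ∀ s t, s.1 ≠ t.1 → ∀ x, star (v s) * x * v t = 0 := by
  classical
  obtain ⟨r, p, hp, horth, h1⟩ := exists_minimal_partition B
  -- Equivalence of minimal projections: the classes are the blocks, and the partial isometries from
  -- a representative to the members of its class generate the matrix units.
  let R : Setoid (Fin r) :=
    { r := fun i j ↦ ∃ x, p i * x * p j ≠ 0
      iseqv :=
        { refl := fun i ↦ ⟨1, by rw [mul_one, (hp i).1.mul_self]; exact (hp i).2.1⟩
          symm := by
            rintro i j ⟨x, hx⟩
            refine ⟨star x, fun h ↦ hx ?_⟩
            have := congrArg star h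
            rwa [star_mul, star_mul, star_star, (hp i).1.star_eq, (hp j).1.star_eq, star_zero,
              ← mul_assoc] at this
          trans := by
            rintro i j l ⟨x, hx⟩ ⟨y, hy⟩
            obtain ⟨w, hw1, -, hw2, hw3⟩ := (hp i).exists_partial_isometry (hp j) hx
            refine ⟨w * y, fun h ↦ hy ?_⟩
            calc p j * y * p l = star w * (w * y * p l) := by rw [← hw1]; noncomm_ring
              _ = star w * (p i * (w * y) * p l) := by rw [← mul_assoc (p i), hw2]
              _ = 0 := by rw [h, mul_zero] } }
  let e := Fintype.equivFin (Quotient R)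
  let cl : Fin r → Fin (Fintype.card (Quotient R)) := fun i ↦ e (Quotient.mk R i)
  let rep : Fin (Fintype.card (Quotient R)) → Fin r := fun j ↦ (e.symm j).out
  have hrep : ∀ i, ∃ x, p i * x * p (rep (cl i)) ≠ 0 := by
    intro i
    have : Quotient.mk R i = Quotient.mk R (rep (cl i)) := by simp [rep, cl]
    exact Quotient.exact this
  have hrep' : ∀ j, cl (rep j) = j := by intro j; simp [rep, cl]
  have hiso : ∀ i, ∃ w, star w * w = p (rep (cl i)) ∧ w * star w = p i ∧ p i * w = w ∧
      w * p (rep (cl i)) = w := by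
    intro i
    obtain ⟨x, hx⟩ := hrep i
    exact (hp i).exists_partial_isometry (hp _) hx
  choose w hw1 hw2 hw3 hw4 using hiso
  let f : ∀ j, Fin (Fintype.card {i // cl i = j}) ≃ {i // cl i = j} :=
    fun j ↦ (Fintype.equivFin _).symm
  let g : (Σ j, Fin (Fintype.card {i // cl i = j})) ≃ Fin r :=
    (Equiv.sigmaCongrRight f).trans (Equiv.sigmaFiberEquiv cl)
  have hg : ∀ s, cl (g s) = s.1 := fun s ↦ (f s.1 s.2).2
  refine ⟨_, fun j ↦ Fintype.card {i // cl i = j}, fun s ↦ w (g s), fun j ↦ p (rep j),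
    fun j ↦ Fintype.card_pos_iff.2 ⟨⟨rep j, hrep' j⟩⟩, ⟨fun s ↦ ?_, fun s t hst ↦ ?_, fun s ↦ ?_,
    ?_, fun j ↦ (hp _).2.1⟩, fun j ↦ hp _, fun s t hst x ↦ ?_⟩
  · rw [hw1, hg]
  · rw [← hw3 (g s), ← hw3 (g t), star_mul, (hp _).1.star_eq, mul_assoc, ← mul_assoc (p (g s)),
      horth _ _ (g.injective.ne hst), zero_mul, mul_zero]
  · have := hw4 (g s)
    rwa [hg] at this
  · simp only [hw2]
    rw [Equiv.sum_comp g p, h1]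
  · by_contra hne
    apply hst
    rw [← hg s, ← hg t]
    refine congrArg e (Quotient.sound (s := R) ⟨x, fun h ↦ hne ?_⟩)
    simp only
    rw [← hw3 (g s), ← hw3 (g t), star_mul, (hp _).1.star_eq]
    calc _ = star (w (g s)) * (p (g s) * x * p (g t)) * w (g t) := by noncomm_ring
      _ = 0 := by rw [h, mul_zero, zero_mul]

/-- A finite-dimensional `C^*`-algebra is a multi-matrix algebra. -/
theorem exists_multiMatrix_equiv : ∃ (k : ℕ) (m : Fin k → ℕ), (∀ j, 0 < m j) ∧
    Nonempty (B ≃⋆ₐ[ℂ] MultiMatrix m) := by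
  obtain ⟨k, m, v, p, hm, h, hp, hb⟩ := exists_isMatrixSystem B
  exact ⟨k, m, hm, ⟨(StarAlgEquiv.ofBijective h.hom
    ⟨h.hom_injective, h.hom_surjective hp hb⟩).symm⟩⟩

variable {B} in
/-- The irreducible representation on a factor of a multi-matrix algebra. -/
noncomputable def Irrep.ofEquiv {k : ℕ} {m : Fin k → ℕ} (hm : ∀ j, 0 < m j)
    (ψ : B ≃⋆ₐ[ℂ] MultiMatrix m) (j : Fin k) : Irrep B where
  dim := m j
  hom :=
    { toFun := fun b ↦ ψ b j
      map_one' := by simp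
      map_mul' := by simp
      map_zero' := by simp
      map_add' := by simp
      commutes' := fun c ↦ by simp [Algebra.algebraMap_eq_smul_one]
      map_star' := fun b ↦ by rw [map_star]; rfl }
  dim_pos := hm j
  irreducible W hW := by
    classical
    refine or_iff_not_imp_left.2 fun h ↦ ?_
    obtain ⟨w, hw, hw0⟩ := W.exists_mem_ne_zero_of_ne_bot h
    obtain ⟨i, hi⟩ := Function.ne_iff.1 hw0
    refine eq_top_iff.2 fun z _ ↦ ?_
    -- This rank-one matrix sends `w` to `z`.
    have : (ψ (ψ.symm (Pi.single j (Matrix.vecMulVec z (Pi.single i (w i)⁻¹)))) j).mulVec w ∈ W :=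
      hW _ w hw
    rw [StarAlgEquiv.apply_symm_apply, Pi.single_eq_same] at this
    convert this using 1
    simp at hi
    ext l
    simp [Matrix.vecMulVec_mulVec, hi]

variable {B} in
theorem algRank_eq_card_of_minimal {ι : Type*}
    [Fintype ι] {p : ι → B} (hp : ∀ i, IsMinimalProjection (p i)) (h1 : ∑ i, p i = 1) :
    algRank B = Fintype.card ι := by
  obtain ⟨k, m, hm, ⟨ψ⟩⟩ := exists_multiMatrix_equiv B
  refine algRank_eq_card hp h1 fun i ↦ ?_
  have h2 : ψ (p i) ≠ 0 := by
    rw [Ne, map_eq_zero_iff ψ ψ.injective]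
    exact (hp i).2.1
  obtain ⟨j, hj⟩ := Function.ne_iff.1 h2
  exact ⟨Irrep.ofEquiv hm ψ j, hj⟩

end Structure

/-! ### Perturbation of partial isometries -/

section PartialIsometries

variable {B : Type*} [CStarAlgebra B]

theorem IsStarProjection.eq_zero_of_norm_lt_one {p : B} (hp : IsStarProjection p)
    (h : ‖p‖ < 1) : p = 0 := by
  have h1 := CStarRing.norm_star_mul_self (x := p)
  rw [hp.star_eq, hp.mul_self] at h1
  by_contra h0
  have : 0 < ‖p‖ := norm_pos_iff.2 h0
  nlinarith

theorem IsStarProjection.mul_eq_of_star_mul {p w : B} (hp : IsStarProjection p)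
    (h : star w * w = p) : w * p = w := by
  have h1 : star (w * (1 - p)) * (w * (1 - p)) = 0 := by
    rw [star_mul, star_sub, star_one, hp.star_eq]
    calc _ = (1 - p) * (star w * w) * (1 - p) := by noncomm_ring
      _ = (p - p * p) * (1 - p) := by rw [h]; noncomm_ring
      _ = 0 := by rw [hp.mul_self, sub_self, zero_mul]
  have h2 := (CStarRing.star_mul_self_eq_zero_iff _).1 h1
  rw [mul_sub, mul_one, sub_eq_zero] at h2
  exact h2.symm

theorem IsStarProjection.mul_eq_of_mul_star {p w : B} (hp : IsStarProjection p)
    (h : w * star w = p) : p * w = w := by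
  have := congrArg star (hp.mul_eq_of_star_mul (w := star w) (by rw [star_star, h]))
  rwa [star_mul, star_star, hp.star_eq] at this

/-- The function `t ↦ t ^ (-1/2)`, cut off near zero. -/
noncomputable def cutoffInvSqrt (t : ℝ) : ℝ := (√(max t (1 / 2)))⁻¹

theorem continuous_cutoffInvSqrt : Continuous cutoffInvSqrt := by
  refine Continuous.inv₀ (by fun_prop) fun t ↦ ?_
  have : (0 : ℝ) < max t (1 / 2) := lt_max_of_lt_right (by norm_num)
  exact (Real.sqrt_pos.2 this).ne'

theorem cutoffInvSqrt_mul {t : ℝ} (ht : 1 / 2 ≤ t) :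
    cutoffInvSqrt t * (t * cutoffInvSqrt t) = 1 := by
  have h3 : 0 < t := by linarith
  have h4 := Real.sqrt_pos.2 h3
  simp only [cutoffInvSqrt, max_eq_left ht]
  nth_rewrite 2 [← Real.mul_self_sqrt h3.le]
  field_simp

theorem cfc_cutoffInvSqrt_mul {a : B} (ha : IsSelfAdjoint a) (h : ‖a - 1‖ < 1 / 2) :
    cfc cutoffInvSqrt a * (a * cfc cutoffInvSqrt a) = 1 := by
  have hf := continuous_cutoffInvSqrt
  have hspec : ∀ t ∈ spectrum ℝ a, 1 / 2 ≤ t := by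
    intro t ht
    have h5 := norm_apply_le_norm_cfc (fun t : ℝ ↦ t - 1) a ht (by fun_prop) ha
    rw [cfc_sub (fun t : ℝ ↦ t) (fun _ ↦ 1) a (by fun_prop) (by fun_prop), cfc_id' ℝ a ha,
      cfc_const_one ℝ a ha] at h5
    have h6 := h5.trans h.le
    rw [Real.norm_eq_abs, abs_le] at h6
    linarith
  have e3 : a * cfc cutoffInvSqrt a = cfc (fun t ↦ t * cutoffInvSqrt t) a := by
    rw [cfc_mul (fun t ↦ t) cutoffInvSqrt a continuousOn_id hf.continuousOn, cfc_id' ℝ a ha]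
  rw [e3, ← cfc_mul cutoffInvSqrt (fun t ↦ t * cutoffInvSqrt t) a hf.continuousOn
    (continuous_id.mul hf).continuousOn, ← cfc_one ℝ a ha]
  exact cfc_congr fun t ht ↦ cutoffInvSqrt_mul (hspec t ht)

/-- Polar decomposition: `a` is near one and commutes with `P`, so `v = u * a ^ (-1/2)` satisfies
`star v * v = P`. Then `Q - v * star v` is a projection of norm below one, hence zero. -/
theorem polar_of_near {P Q u a : B} (hP : IsStarProjection P) (hQ : IsStarProjection Q)
    (huP : u * P = u) (hQu : Q * u = u) (ha : a = star u * u + (1 - P)) (hsa : IsSelfAdjoint a)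
    (h1 : ‖a - 1‖ < 1 / 2)
    (h2 : ‖Q - u * cfc cutoffInvSqrt a * star (u * cfc cutoffInvSqrt a)‖ < 1) :
    star (u * cfc cutoffInvSqrt a) * (u * cfc cutoffInvSqrt a) = P ∧
      u * cfc cutoffInvSqrt a * star (u * cfc cutoffInvSqrt a) = Q := by
  have hcac := cfc_cutoffInvSqrt_mul hsa h1
  have hcs : star (cfc cutoffInvSqrt a) = cfc cutoffInvSqrt a :=
    (cfc_predicate cutoffInvSqrt a : IsSelfAdjoint _)
  have hPu : P * star u = star u := by
    have := congrArg star huP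
    rwa [star_mul, hP.star_eq] at this
  have hcomm : Commute a P := by
    rw [Commute, SemiconjBy, ha, add_mul, mul_add, mul_assoc, huP, ← mul_assoc, hPu,
      sub_mul, mul_sub, hP.mul_self, one_mul, mul_one]
  have hcP : cfc cutoffInvSqrt a * P = P * cfc cutoffInvSqrt a := hcomm.cfc_real _
  have huu : star u * u = a * P := by
    rw [ha, add_mul, mul_assoc, huP, sub_mul, hP.mul_self, one_mul, sub_self, add_zero]
  generalize cfc cutoffInvSqrt a = c at *
  have hvv : star (u * c) * (u * c) = P := by
    rw [star_mul, hcs]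
    calc _ = c * (star u * u) * c := by noncomm_ring
      _ = c * a * (P * c) := by rw [huu]; noncomm_ring
      _ = c * (a * c) * P := by rw [← hcP]; noncomm_ring
      _ = P := by rw [hcac, one_mul]
  refine ⟨hvv, ?_⟩
  have hQv : Q * (u * c) = u * c := by rw [← mul_assoc, hQu]
  generalize u * c = v at *
  have hvP : v * P = v := hP.mul_eq_of_star_mul hvv
  have hvQ : star v * Q = star v := by
    have := congrArg star hQv
    rwa [star_mul, hQ.star_eq] at this
  have hproj : IsStarProjection (Q - v * star v) := by
    refine ⟨?_, hQ.isSelfAdjoint.sub (IsSelfAdjoint.mul_star_self _)⟩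
    have e4 : v * star v * (v * star v) = v * star v := by
      calc _ = v * (star v * v) * star v := by noncomm_ring
        _ = _ := by rw [hvv, hvP]
    rw [IsIdempotentElem, mul_sub, sub_mul, sub_mul, hQ.mul_self, e4, ← mul_assoc, hQv, mul_assoc,
      hvQ]
    abel
  exact (sub_eq_zero.1 (hproj.eq_zero_of_norm_lt_one h2)).symm

end PartialIsometries

/-! ### Extending projections, partial isometries and matrix units to nearby fibres -/

section Lifting

variable {X : Type*} [TopologicalSpace X] {A : X → Type*} [∀ x, CStarAlgebra (A x)]
  [TopologicalSpace (TotSpace A)] [IsUnitalFellBundle A]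

theorem eventually_norm_section_sub_lt {s t : ∀ x, A x} (hs : s ∈ ContSections A)
    (ht : t ∈ ContSections A) {x : X} {e : ℝ} (h : ‖s x - t x‖ < e) :
    ∀ᶠ y in 𝓝 x, ‖s y - t y‖ < e :=
  (continuous_norm_contSection (sub_mem hs ht)).continuousAt.preimage_mem_nhds (Iio_mem_nhds h)

theorem eventually_ne_zero {s : ∀ x, A x} (hs : s ∈ ContSections A) {x : X} (h : s x ≠ 0) :
    ∀ᶠ y in 𝓝 x, s y ≠ 0 := by
  have := (continuous_norm_contSection hs).continuousAt.preimage_mem_nhds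
    (Ioi_mem_nhds (norm_pos_iff.2 h))
  filter_upwards [this] with y hy
  exact norm_pos_iff.1 hy

variable [CompactSpace X] [T2Space X] [∀ x, FiniteDimensional ℂ (A x)]

/-- A finite partition of the unit of a fibre into orthogonal projections extends to nearby
fibres. -/
theorem exists_lift_projections {x : X} {r : ℕ} {p : Fin r → A x} (hr : 0 < r)
    (hp : ∀ i, IsStarProjection (p i)) (horth : ∀ i j, i ≠ j → p i * p j = 0)
    (h1 : ∑ i, p i = 1) :
    ∃ P : Fin r → ∀ y, A y, (∀ i, P i ∈ ContSections A) ∧ (∀ i, P i x = p i) ∧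
      ∀ᶠ y in 𝓝 x, (∀ i, IsStarProjection (P i y)) ∧ (∀ i j, i ≠ j → P i y * P j y = 0) ∧
        ∑ i, P i y = 1 := by
  -- The whole partition is encoded in one self-adjoint element with distinct integer eigenvalues.
  -- Functions of a single extension of it are then automatically orthogonal.
  obtain ⟨s, hs, hsx⟩ := exists_contSection_eq (A := A) (x := x) (∑ i : Fin r, ((i : ℕ) : ℂ) • p i)
  let h : ∀ y, A y := (2⁻¹ : ℂ) • (s + star s)
  have hh : h ∈ ContSections A :=
    SMulMemClass.smul_mem _ (add_mem hs (star_mem hs))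
  have hsa : ∀ y, IsSelfAdjoint (h y) := by
    intro y
    simp [h, IsSelfAdjoint, star_smul, add_comm]
  have hhx : h x = ∑ i : Fin r, ((i : ℕ) : ℂ) • p i := by
    have : star (s x) = s x := by
      rw [hsx, star_sum]
      refine Finset.sum_congr rfl fun i _ ↦ ?_
      rw [star_smul, (hp i).star_eq]; simp
    simp only [h, Pi.smul_apply, Pi.add_apply, Pi.star_apply, this, ← two_smul ℂ (s x), smul_smul]
    norm_num [hsx]
  have hph : ∀ i : Fin r, p i * h x = ((i : ℕ) : ℂ) • p i := by
    intro i
    rw [hhx, Finset.mul_sum, Finset.sum_eq_single_of_mem i (Finset.mem_univ _), mul_smul_comm,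
      (hp i).mul_self]
    intro j _ hj
    rw [mul_smul_comm, horth i j hj.symm, smul_zero]
  let S : Set ℝ := Set.range fun i : Fin r ↦ ((i : ℕ) : ℝ)
  have hS : S.Nonempty := ⟨_, ⟨⟨0, hr⟩, rfl⟩⟩
  have hspec : ∀ t ∈ spectrum ℝ (h x), t ∈ S := by
    intro t ht
    obtain ⟨q, hq, hq0, hqt⟩ := exists_spectral_projection (hsa x) ht
    obtain ⟨i, hi⟩ : ∃ i, p i * q ≠ 0 := by
      by_contra! H
      apply hq0
      rw [← one_mul q, ← h1, Finset.sum_mul]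
      exact Finset.sum_eq_zero fun i _ ↦ H i
    refine ⟨i, ?_⟩
    have h2 : ((i : ℕ) : ℂ) • (p i * q) = (t : ℂ) • (p i * q) := by
      rw [← smul_mul_assoc, ← hph, mul_assoc, hqt, mul_smul_comm]
    have h3 := smul_left_injective ℂ hi h2
    exact_mod_cast h3
  -- A bump equal to one within `1 / 3` of `i` and to zero beyond `2 / 3`; on points within `1 / 3`
  -- of the integers below `r` the bumps are disjoint indicator functions.
  let f : Fin r → ℝ → ℝ := fun i t ↦ max 0 (min 1 (2 - 3 * |t - i|))
  have hf : ∀ i, Continuous (f i) := fun i ↦ by fun_prop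
  have hfv : ∀ i j : Fin r, ∀ t : ℝ, |t - i| < 1 / 3 → f j t = if j = i then 1 else 0 := by
    intro i j t ht
    by_cases hij : j = i
    · subst hij
      simp only [f, if_true]
      rw [min_eq_left (by linarith), max_eq_right zero_le_one]
    · have h2 : (1 : ℝ) ≤ |(i : ℝ) - j| := by
        have h3 : (1 : ℤ) ≤ |((i : ℕ) : ℤ) - (j : ℕ)| := by
          apply Int.one_le_abs
          intro h4
          apply hij
          ext
          omega
        exact_mod_cast h3
      have h3 : |(i : ℝ) - j| ≤ |t - i| + |t - j| := by
        have := abs_sub_le (i : ℝ) t j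
        rwa [abs_sub_comm (i : ℝ) t] at this
      simp only [f, if_neg hij]
      rw [max_eq_left]
      exact (min_le_right _ _).trans (by linarith)
  -- Applying the distance to `S` turns control of nearby spectra into continuity of a norm: this
  -- section vanishes at `x`, so spectra of nearby fibres stay within `1 / 3` of `S`.
  have hg : Continuous fun t : ℝ ↦ Metric.infDist t S := Metric.continuous_infDist_pt S
  have hgx : cfc (fun t : ℝ ↦ Metric.infDist t S) (h x) = 0 := by
    rw [← cfc_zero ℝ (h x)]
    exact cfc_congr fun t ht ↦ Metric.infDist_zero_of_mem (hspec t ht)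
  have hgm := cfc_mem_contSections hh hsa hg
  have hev : ∀ᶠ y in 𝓝 x, ∀ t ∈ spectrum ℝ (h y), ∃ i : Fin r, |t - i| < 1 / 3 := by
    have := eventually_norm_section_sub_lt hgm (zero_mem (ContSections A)) (x := x) (e := 1 / 3) (by
      simp [hgx])
    filter_upwards [this] with y hy t ht
    have h2 := norm_apply_le_norm_cfc (fun t : ℝ ↦ Metric.infDist t S) (h y) ht
      hg.continuousOn (hsa y)
    rw [Pi.zero_apply, sub_zero] at hy
    rw [Real.norm_of_nonneg Metric.infDist_nonneg] at h2
    obtain ⟨_, ⟨i, rfl⟩, h3⟩ := (Metric.infDist_lt_iff hS).1 (h2.trans_lt hy)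
    exact ⟨i, h3⟩
  have hev2 : ∀ y, (∀ t ∈ spectrum ℝ (h y), ∃ i : Fin r, |t - i| < 1 / 3) →
      (∀ i, IsStarProjection (cfc (f i) (h y))) ∧
      (∀ i j, i ≠ j → cfc (f i) (h y) * cfc (f j) (h y) = 0) ∧ ∑ i, cfc (f i) (h y) = 1 := by
    intro y hy
    refine ⟨fun i ↦ ⟨?_, cfc_predicate _ _⟩, fun i j hij ↦ ?_, ?_⟩
    · rw [IsIdempotentElem, ← cfc_mul (f i) (f i) (h y) (hf i).continuousOn (hf i).continuousOn]
      refine cfc_congr fun t ht ↦ ?_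
      obtain ⟨l, hl⟩ := hy t ht
      simp only [hfv l i t hl]
      split_ifs <;> simp
    · rw [← cfc_mul (f i) (f j) (h y) (hf i).continuousOn (hf j).continuousOn,
        ← cfc_zero ℝ (h y)]
      refine cfc_congr fun t ht ↦ ?_
      obtain ⟨l, hl⟩ := hy t ht
      simp only [hfv l i t hl, hfv l j t hl]
      split_ifs with h3 h4
      · exact absurd (h3.trans h4.symm) hij
      all_goals simp
    · rw [← cfc_sum_univ f (h y) fun i ↦ (hf i).continuousOn, ← cfc_one ℝ (h y) (hsa y)]
      refine cfc_congr fun t ht ↦ ?_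
      obtain ⟨l, hl⟩ := hy t ht
      simp [Finset.sum_apply, hfv l _ t hl]
  refine ⟨fun i y ↦ cfc (f i) (h y), fun i ↦ cfc_mem_contSections hh hsa (hf i), ?_,
    hev.mono hev2⟩
  obtain ⟨-, -, hPsum⟩ := hev2 x hev.self_of_nhds
  have hhP : ∀ j, h x * cfc (f j) (h x) = ((j : ℕ) : ℂ) • cfc (f j) (h x) := by
    intro j
    nth_rewrite 1 [← cfc_id ℝ (h x) (hsa x)]
    rw [← cfc_mul id (f j) (h x) continuousOn_id (hf j).continuousOn]
    have : ((j : ℕ) : ℂ) • cfc (f j) (h x) = ((j : ℕ) : ℝ) • cfc (f j) (h x) := by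
      rw [← Complex.coe_smul]; simp
    rw [this, ← cfc_smul _ (f j) (h x) (hf j).continuousOn]
    refine cfc_congr fun t ht ↦ ?_
    obtain ⟨i, rfl⟩ := hspec t ht
    have := hfv i j i (by simp)
    simp only [this, id, smul_eq_mul]
    split_ifs with h3
    · rw [h3]
    · simp
  have hpP : ∀ i j, i ≠ j → p i * cfc (f j) (h x) = 0 := by
    intro i j hij
    have h2 : ((i : ℕ) : ℂ) • (p i * cfc (f j) (h x)) = ((j : ℕ) : ℂ) • (p i * cfc (f j) (h x)) := by
      rw [← smul_mul_assoc, ← hph, mul_assoc, hhP, mul_smul_comm]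
    by_contra h0
    have h3 := smul_left_injective ℂ h0 h2
    apply hij
    ext
    exact_mod_cast h3
  intro j
  calc cfc (f j) (h x) = ∑ i, p i * cfc (f j) (h x) := by rw [← Finset.sum_mul, h1, one_mul]
    _ = p j * cfc (f j) (h x) := Finset.sum_eq_single_of_mem j (Finset.mem_univ _)
        fun i _ hij ↦ hpP i j hij
    _ = ∑ i, p j * cfc (f i) (h x) := (Finset.sum_eq_single_of_mem j (Finset.mem_univ _)
        fun i _ hij ↦ hpP j i hij.symm).symm
    _ = p j := by rw [← Finset.mul_sum, hPsum, mul_one]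

theorem exists_lift_projection {x : X} {p : A x} (hp : IsStarProjection p) :
    ∃ P ∈ ContSections A, P x = p ∧ ∀ᶠ y in 𝓝 x, IsStarProjection (P y) := by
  have h1 : IsStarProjection (1 - p) := hp.one_sub
  obtain ⟨P, hP, hPx, h⟩ := exists_lift_projections (A := A) (x := x) (p := ![p, 1 - p]) two_pos
    (by simp [Fin.forall_fin_two, hp, h1])
    (by simp [Fin.forall_fin_two, mul_sub, sub_mul, hp.mul_self]) (by simp)
  exact ⟨P 0, hP 0, by simp [hPx], h.mono fun y hy ↦ hy.1 0⟩

/-- A partial isometry of a fibre extends to nearby fibres, with prescribed extensions of its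
initial and final projections. -/
theorem exists_lift_partial_isometry {x : X} {P Q : ∀ y, A y} (hP : P ∈ ContSections A)
    (hQ : Q ∈ ContSections A) (hPp : ∀ᶠ y in 𝓝 x, IsStarProjection (P y))
    (hQp : ∀ᶠ y in 𝓝 x, IsStarProjection (Q y)) {w : A x} (h1 : star w * w = P x)
    (h2 : w * star w = Q x) :
    ∃ v ∈ ContSections A, v x = w ∧ ∀ᶠ y in 𝓝 x, star (v y) * v y = P y ∧
      v y * star (v y) = Q y := by
  obtain ⟨w₀, hw₀, hw₀x⟩ := exists_contSection_eq w
  let u : ∀ y, A y := Q * w₀ * P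
  have hu : u ∈ ContSections A := mul_mem (mul_mem hQ hw₀) hP
  have hwP := hPp.self_of_nhds.mul_eq_of_star_mul h1
  have hQw := hQp.self_of_nhds.mul_eq_of_mul_star h2
  have hux : u x = w := by simp [u, hw₀x, hQw, hwP]
  -- The second summand is written as `star (1 - P) * (1 - P)` so that `a` is self-adjoint in every
  -- fibre, including those where `P` is not a projection.
  let a : ∀ y, A y := star u * u + star (1 - P) * (1 - P)
  have ha : a ∈ ContSections A :=
    add_mem (mul_mem (star_mem hu) hu) (mul_mem (star_mem (sub_mem (one_mem _) hP))
      (sub_mem (one_mem _) hP))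
  have hsa : ∀ y, IsSelfAdjoint (a y) := fun y ↦
    (IsSelfAdjoint.star_mul_self (u y)).add (IsSelfAdjoint.star_mul_self ((1 - P) y))
  have hay : ∀ y, IsStarProjection (P y) → a y = star (u y) * u y + (1 - P y) := by
    intro y hy
    simp only [a, Pi.add_apply, Pi.mul_apply, Pi.star_apply, Pi.sub_apply, Pi.one_apply]
    rw [star_sub, star_one, hy.star_eq, mul_sub, sub_mul, sub_mul, hy.mul_self]
    simp
  have hax : a x = 1 := by rw [hay x hPp.self_of_nhds, hux, h1]; simp
  let c : ∀ y, A y := fun y ↦ cfc cutoffInvSqrt (a y)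
  have hc : c ∈ ContSections A := cfc_mem_contSections ha hsa continuous_cutoffInvSqrt
  have hcx : c x = 1 := by
    simp only [c, hax]
    rw [cfc_apply_one]
    norm_num [cutoffInvSqrt]
  let v : ∀ y, A y := u * c
  have hv : v ∈ ContSections A := mul_mem hu hc
  have hvx : v x = w := by simp [v, hcx, hux]
  refine ⟨v, hv, hvx, ?_⟩
  have e1 := eventually_norm_section_sub_lt ha (one_mem (ContSections A)) (x := x) (e := 1 / 2)
    (by simp [hax])
  have e2 := eventually_norm_section_sub_lt hQ (mul_mem hv (star_mem hv)) (x := x) (e := 1)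
    (by simp [hvx, h2])
  filter_upwards [e1, e2, hPp, hQp] with y h3 h4 hPy hQy
  refine polar_of_near hPy hQy (by simp [u, mul_assoc, hPy.mul_self])
    (by simp [u, ← mul_assoc, hQy.mul_self]) (hay y hPy) (hsa y) h3 h4

/-- A system of matrix units of a fibre extends to nearby fibres. -/
theorem exists_lift_matrixSystem [∀ x, Nontrivial (A x)] {x : X} {k : ℕ} {m : Fin k → ℕ}
    {v : (Σ j, Fin (m j)) → A x} {p : Fin k → A x} (h : IsMatrixSystem m v p)
    (hm : ∀ j, 0 < m j) :
    ∃ (V : (Σ j, Fin (m j)) → ∀ y, A y) (P : Fin k → ∀ y, A y),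
      (∀ s, V s ∈ ContSections A) ∧ (∀ s, V s x = v s) ∧ (∀ j, P j x = p j) ∧
        ∀ᶠ y in 𝓝 x, IsMatrixSystem m (fun s ↦ V s y) (fun j ↦ P j y) := by
  classical
  have hp : ∀ j, IsStarProjection (p j) := by
    intro j
    let s : Σ j, Fin (m j) := ⟨j, ⟨0, hm j⟩⟩
    refine ⟨?_, h.star_init s⟩
    rw [IsIdempotentElem]
    calc p j * p j = star (v s) * v s * p s.1 := by rw [h.star_mul_self]
      _ = p j := by rw [mul_assoc, h.mul_init, h.star_mul_self]
  have hq : ∀ s, IsStarProjection (v s * star (v s)) := by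
    intro s
    refine ⟨?_, IsSelfAdjoint.mul_star_self _⟩
    rw [IsIdempotentElem]
    calc _ = v s * (star (v s) * v s) * star (v s) := by noncomm_ring
      _ = _ := by rw [h.star_mul_self, h.mul_init]
  choose P hP hPx hPp using fun j ↦ exists_lift_projection (hp j)
  let e := Fintype.equivFin (Σ j, Fin (m j))
  have hpos : 0 < Fintype.card (Σ j, Fin (m j)) := by
    rw [Fintype.card_pos_iff]
    by_contra hne
    rw [not_nonempty_iff] at hne
    exact zero_ne_one (α := A x) (by simpa using h.sum_eq_one)
  -- The final projections are lifted jointly, to remain orthogonal with sum one; the initial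
  -- projections `p j` need no mutual relation and are lifted one by one.
  obtain ⟨Q, hQ, hQx, hQp⟩ := exists_lift_projections (A := A) (x := x)
    (p := fun i ↦ v (e.symm i) * star (v (e.symm i))) hpos (fun i ↦ hq _)
    (fun i j hij ↦ by
      calc _ = v (e.symm i) * (star (v (e.symm i)) * v (e.symm j)) * star (v (e.symm j)) := by
            noncomm_ring
        _ = 0 := by rw [h.star_mul_of_ne _ _ (e.symm.injective.ne hij)]; simp)
    (by rw [Equiv.sum_comp e.symm (fun s ↦ v s * star (v s)), h.sum_eq_one])
  have key : ∀ s : Σ j, Fin (m j), ∃ V ∈ ContSections A, V x = v s ∧ ∀ᶠ y in 𝓝 x,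
      star (V y) * V y = P s.1 y ∧ V y * star (V y) = Q (e s) y := by
    intro s
    refine exists_lift_partial_isometry (hP s.1) (hQ (e s)) (hPp s.1)
      (hQp.mono fun y hy ↦ hy.1 _) ?_ ?_
    · rw [hPx, h.star_mul_self]
    · simp [hQx]
  choose V hV hVx hVy using key
  refine ⟨V, P, hV, hVx, hPx, ?_⟩
  have hne : ∀ᶠ y in 𝓝 x, ∀ j, P j y ≠ 0 := by
    rw [eventually_all]
    exact fun j ↦ eventually_ne_zero (hP j) (by rw [hPx]; exact h.ne_zero j)
  filter_upwards [hQp, eventually_all.2 hPp, eventually_all.2 hVy, hne] with y h1 h2 h3 h4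
  refine ⟨fun s ↦ (h3 s).1, fun s t hst ↦ ?_, fun s ↦ (h2 s.1).mul_eq_of_star_mul (h3 s).1, ?_, h4⟩
  · have e1 := (h1.1 (e s)).mul_eq_of_mul_star (h3 s).2
    have e2 := (h1.1 (e t)).mul_eq_of_mul_star (h3 t).2
    rw [← e1, ← e2, star_mul, (h1.1 _).star_eq, mul_assoc, ← mul_assoc (Q (e s) y),
      h1.2.1 _ _ (e.injective.ne hst), zero_mul, mul_zero]
  · rw [Finset.sum_congr rfl fun s _ ↦ (h3 s).2, Equiv.sum_comp e (fun i ↦ Q i y), h1.2.2]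

end Lifting

/-! ### Subbundles -/

section SubBundle

set_option linter.unusedSectionVars false

variable {X : Type*} [TopologicalSpace X] {A : X → Type*} [∀ x, CStarAlgebra (A x)]
  [TopologicalSpace (TotSpace A)]

/-- The inclusion of the total space of a subbundle. -/
def TotSpace.incl {U : Set X} (B : ∀ y : U, StarSubalgebra ℂ (A y))
    (p : TotSpace fun y : U ↦ B y) : TotSpace A := ⟨p.pt, p.vec⟩

theorem TotSpace.isInducing_incl {U : Set X} (B : ∀ y : U, StarSubalgebra ℂ (A y)) :
    IsInducing (TotSpace.incl B) := ⟨rfl⟩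

theorem TotSq.continuous_incl {U : Set X} (B : ∀ y : U, StarSubalgebra ℂ (A y)) :
    Continuous fun p : TotSq (fun y : U ↦ B y) ↦ (⟨p.pt, p.fst, p.snd⟩ : TotSq A) := by
  have h : Continuous (TotSq.toProd (A := fun y : U ↦ B y)) := continuous_induced_dom
  exact continuous_induced_rng.2
    (((TotSpace.isInducing_incl B).continuous.comp (continuous_fst.comp h)).prodMk
      ((TotSpace.isInducing_incl B).continuous.comp (continuous_snd.comp h)))

/-- All the axioms pass to the subspace topology except openness of the projection, for which a
continuous section through each point suffices. -/
theorem isUnitalFellBundle_of_sections [IsUnitalFellBundle A] {U : Set X}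
    (B : ∀ y : U, StarSubalgebra ℂ (A y))
    (hB : ∀ (y : U) (b : B y), ∃ s : ∀ z : U, B z, s y = b ∧
      Continuous fun z : U ↦ (⟨z, s z⟩ : TotSpace A)) :
    IsUnitalFellBundle fun y : U ↦ B y := by
  have hJ := TotSpace.isInducing_incl B
  refine ⟨?_, ?_, ?_, ?_, ?_, ?_, ?_, ?_, ?_⟩
  · exact continuous_induced_rng.2 ((IsUnitalFellBundle.continuous_proj (A := A)).comp hJ.continuous)
  · refine IsOpenMap.of_nhds_le fun p V hV ↦ ?_
    obtain ⟨s, hs, hsc⟩ := hB p.pt p.vec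
    have hc : Continuous fun z : U ↦ (⟨z, s z⟩ : TotSpace fun y : U ↦ B y) :=
      hJ.continuous_iff.2 hsc
    have hp : (⟨p.pt, s p.pt⟩ : TotSpace fun y : U ↦ B y) = p := by rw [hs]
    have := hc.continuousAt (x := p.pt)
    rw [ContinuousAt, hp] at this
    exact this hV
  · exact hJ.continuous_iff.2
      ((IsUnitalFellBundle.continuous_add (A := A)).comp (TotSq.continuous_incl B))
  · exact hJ.continuous_iff.2 ((IsUnitalFellBundle.continuous_smul (A := A)).comp
      (continuous_fst.prodMk (hJ.continuous.comp continuous_snd)))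
  · exact hJ.continuous_iff.2
      ((IsUnitalFellBundle.continuous_mul (A := A)).comp (TotSq.continuous_incl B))
  · exact hJ.continuous_iff.2 ((IsUnitalFellBundle.continuous_star (A := A)).comp hJ.continuous)
  · exact hJ.continuous_iff.2
      ((IsUnitalFellBundle.continuous_one (A := A)).comp continuous_subtype_val)
  · exact (IsUnitalFellBundle.continuous_norm (A := A)).comp hJ.continuous
  · intro x
    rw [hJ.nhds_eq_comap]
    refine ((IsUnitalFellBundle.nhds_zero (A := A) (x : X)).comap _).to_hasBasis ?_ ?_
    · rintro ⟨W, e⟩ ⟨hW, he⟩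
      exact ⟨(Subtype.val ⁻¹' W, e), ⟨continuous_subtype_val.continuousAt.preimage_mem_nhds hW, he⟩,
        fun p hp ↦ hp⟩
    · rintro ⟨W, e⟩ ⟨hW, he⟩
      rw [nhds_subtype, mem_comap] at hW
      obtain ⟨W', hW', h⟩ := hW
      exact ⟨(W', e), ⟨hW', he⟩, fun p hp ↦ ⟨h hp.1, hp.2⟩⟩

end SubBundle

/-! ### Bratteli matrices of systems of matrix units -/

section Bratteli

open Matrix
open scoped ComplexOrder

theorem Matrix.isMinimalProjection_single {n : ℕ} (a : Fin n) :
    IsMinimalProjection (Matrix.single a a 1 : Matrix (Fin n) (Fin n) ℂ) := by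
  refine ⟨⟨by simp [IsIdempotentElem], ?_⟩, fun h ↦ ?_, fun b ↦ ⟨b a a, ?_⟩⟩
  · rw [IsSelfAdjoint, star_eq_conjTranspose, conjTranspose_single, star_one]
  · simpa using congrFun (congrFun h a) a
  · rw [Matrix.single_mul_mul_single]; simp

theorem Matrix.exists_mul_mul_ne_zero {n : ℕ} {p q : Matrix (Fin n) (Fin n) ℂ} (hp : p ≠ 0)
    (hq : q ≠ 0) : ∃ b, p * b * q ≠ 0 := by
  obtain ⟨i, j, hij⟩ : ∃ i j, p i j ≠ 0 := by
    by_contra! H; exact hp (Matrix.ext H)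
  obtain ⟨k, l, hkl⟩ : ∃ i j, q i j ≠ 0 := by
    by_contra! H; exact hq (Matrix.ext H)
  refine ⟨Matrix.single j k 1, fun h ↦ ?_⟩
  have h1 : (p * Matrix.single j k (1 : ℂ) * q : Matrix (Fin n) (Fin n) ℂ) i l = p i j * q k l := by
    simp [Matrix.mul_apply, Matrix.single_apply, ite_and]
  rw [h, Matrix.zero_apply] at h1
  exact mul_ne_zero hij hkl h1.symm

/-- A tracial functional on a matrix algebra is constant on minimal projections. -/
theorem Matrix.tracial_eq_of_minimal {n : ℕ} {p q : Matrix (Fin n) (Fin n) ℂ}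
    (hp : IsMinimalProjection p) (hq : IsMinimalProjection q)
    {τ : Matrix (Fin n) (Fin n) ℂ →ₗ[ℂ] ℂ} (hτ : ∀ a b, τ (a * b) = τ (b * a)) : τ p = τ q := by
  obtain ⟨b, hb⟩ := Matrix.exists_mul_mul_ne_zero hp.2.1 hq.2.1
  exact hp.trace_eq hq (fun x hx ↦ Matrix.conjTranspose_mul_self_eq_zero.1 hx) hτ hb

theorem Matrix.exists_trace_eq_of_idempotent {n : ℕ} {p : Matrix (Fin n) (Fin n) ℂ}
    (hp : IsIdempotentElem p) : ∃ r : ℕ, r ≤ n ∧ p.trace = r ∧ (r = 0 → p = 0) := by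
  have h1 : IsIdempotentElem (Matrix.toLin' p) := by
    rw [IsIdempotentElem, Module.End.mul_eq_comp, ← Matrix.toLin'_mul, hp.eq]
  have h2 := (LinearMap.IsIdempotentElem.isProj_range _ h1).trace
  rw [Matrix.trace_toLin'_eq] at h2
  refine ⟨_, ?_, h2, fun h ↦ ?_⟩
  · simpa using Submodule.finrank_le (LinearMap.range (Matrix.toLin' p))
  · rw [Submodule.finrank_eq_zero, LinearMap.range_eq_bot] at h
    exact Matrix.toLin'.injective (by rw [h, map_zero])

theorem finrank_multiMatrix {l : ℕ} (n : Fin l → ℕ) :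
    Module.finrank ℂ (MultiMatrix n) = ∑ i, n i * n i := by
  rw [Module.finrank_pi_fintype]
  simp [Module.finrank_matrix]

variable {D : Type*} [CStarAlgebra D] [FiniteDimensional ℂ D]

/-- The embedding defined by a system of matrix units has a Bratteli matrix, bounded in terms of
the dimension. If all columns of it are singletons, the diagonal matrix units are minimal. -/
theorem IsMatrixSystem.exists_isBratteliMatrix {k : ℕ} {m : Fin k → ℕ}
    {v : (Σ j, Fin (m j)) → D} {p : Fin k → D} (h : IsMatrixSystem m v p) (hm : ∀ j, 0 < m j)
    {N : ℕ} (hN : Module.finrank ℂ D ≤ N) :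
    ∃ (l : ℕ) (T : Matrix (Fin l) (Fin k) ℕ), l ≤ N ∧ (∀ i j, T i j ≤ N) ∧
      IsBratteliMatrix h.hom.range.subtype T ∧
      (HasSingletonColumns T → ∀ s, IsMinimalProjection (v s * star (v s))) := by
  classical
  obtain ⟨l, n, hn, ⟨ψ⟩⟩ := exists_multiMatrix_equiv D
  have hdim : ∑ i, n i * n i ≤ N := by
    have e : D ≃ₗ[ℂ] MultiMatrix n := (ψ : D ≃⋆ₐ[ℂ] MultiMatrix n).toAlgEquiv.toLinearEquiv
    rw [← finrank_multiMatrix, ← e.finrank_eq]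
    exact hN
  have hnN : ∀ i, n i ≤ N := fun i ↦ by
    refine le_trans ?_ ((Finset.single_le_sum (f := fun i ↦ n i * n i) (fun i _ ↦ Nat.zero_le _)
      (Finset.mem_univ i)).trans hdim)
    exact Nat.le_mul_of_pos_left _ (hn i)
  have hl : l ≤ N := by
    refine le_trans ?_ hdim
    calc l = ∑ i : Fin l, 1 := by simp
      _ ≤ _ := Finset.sum_le_sum fun i _ ↦ Nat.mul_pos (hn i) (hn i)
  have hψ : ∀ q : D, IsStarProjection q → ∀ i, IsIdempotentElem (ψ q i) := by
    intro q hq i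
    rw [IsIdempotentElem, ← Pi.mul_apply, ← map_mul, hq.mul_self]
  choose! r hrn hr hr0 using fun (q : D) (hq : IsStarProjection q) (i : Fin l) ↦
    Matrix.exists_trace_eq_of_idempotent (hψ q hq i)
  have hvp : ∀ s, IsStarProjection (v s * star (v s)) := by
    intro s
    refine ⟨?_, IsSelfAdjoint.mul_star_self _⟩
    rw [IsIdempotentElem]
    calc _ = v s * (star (v s) * v s) * star (v s) := by noncomm_ring
      _ = _ := by rw [h.star_mul_self, h.mul_init]
  let o : ∀ j, Fin (m j) := fun j ↦ ⟨0, hm j⟩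
  let T : Matrix (Fin l) (Fin k) ℕ := Matrix.of fun i j ↦ r (v ⟨j, o j⟩ * star (v ⟨j, o j⟩)) i
  have hT : ∀ i j, ∀ q : Matrix (Fin (m j)) (Fin (m j)) ℂ, IsMinimalProjection q →
      Matrix.trace (ψ (h.hom (Pi.single j q)) i) = (T i j : ℂ) := by
    intro i j q hq
    -- Pulled back to the `j`-th block, the trace of a factor of `D` is still tracial, so the choice
    -- of minimal projection does not matter and the first diagonal matrix unit may serve.
    let τ : Matrix (Fin (m j)) (Fin (m j)) ℂ →ₗ[ℂ] ℂ :=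
      { toFun := fun q ↦ Matrix.trace (ψ (h.hom (Pi.single j q)) i)
        map_add' := fun a b ↦ by
          rw [Pi.single_add, map_add, map_add, Pi.add_apply, Matrix.trace_add]
        map_smul' := fun c a ↦ by
          rw [Pi.single_smul, map_smul, map_smul, Pi.smul_apply, Matrix.trace_smul]; rfl }
    have hτ : ∀ a b, τ (a * b) = τ (b * a) := by
      intro a b
      change Matrix.trace (ψ (h.hom (Pi.single j (a * b))) i) =
        Matrix.trace (ψ (h.hom (Pi.single j (b * a))) i)
      rw [Pi.single_mul, map_mul, map_mul, Pi.mul_apply, Matrix.trace_mul_comm, Pi.single_mul,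
        map_mul, map_mul, Pi.mul_apply]
    have h1 : τ q = τ _ :=
      Matrix.tracial_eq_of_minimal hq (Matrix.isMinimalProjection_single (o j)) hτ
    change τ q = _
    rw [h1]
    change Matrix.trace (ψ (h.hom _) i) = _
    rw [h.hom_single, hr _ (hvp _)]
    rfl
  refine ⟨l, T, hl, fun i j ↦ (hrn _ (hvp _) i).trans (hnN i),
    ⟨m, n, hm, hn, (StarAlgEquiv.ofInjective h.hom h.hom_injective).symm, ψ, hT⟩, fun hs s ↦ ?_⟩
  -- Each minimal summand of `v s * star (v s)` contributes at least one to the column sum of `T`.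
  -- That sum is one, so there is a single summand.
  obtain ⟨S, hS, -, hsum⟩ := exists_minimal_decomposition (hvp s)
  have hrpos : ∀ q ∈ S, 1 ≤ ∑ i, r q i := by
    intro q hq
    by_contra! H
    have h1 : ∑ i, r q i = 0 := by omega
    rw [Finset.sum_eq_zero_iff] at h1
    apply (hS q hq).2.1
    apply ψ.injective
    rw [map_zero]
    funext i
    exact hr0 q (hS q hq).1 i (h1 i (Finset.mem_univ _))
  have hsum1 : ∑ q ∈ S, ∑ i, r q i = 1 := by
    obtain ⟨i₀, h1, h0⟩ := hs s.1
    have h2 : ∑ i, T i s.1 = 1 := by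
      rw [Finset.sum_eq_single_of_mem i₀ (Finset.mem_univ _) fun i _ hi ↦ h0 i hi, h1]
    rw [← h2, Finset.sum_comm]
    refine Finset.sum_congr rfl fun i _ ↦ ?_
    have h3 := hT i s.1 _ (Matrix.isMinimalProjection_single s.2)
    rw [h.hom_single] at h3
    have h4 : Matrix.trace (ψ (v s * star (v s)) i) = (T i s.1 : ℂ) := h3
    rw [← hsum, map_sum, Finset.sum_apply, Matrix.trace_sum,
      Finset.sum_congr rfl fun q hq ↦ hr q (hS q hq).1 i] at h4
    exact_mod_cast h4
  have hcard : S.card ≤ 1 := by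
    rw [← hsum1, Finset.card_eq_sum_ones]
    exact Finset.sum_le_sum hrpos
  have hne : v s * star (v s) ≠ 0 := by
    intro h0
    have h1 := (CStarRing.mul_star_self_eq_zero_iff _).1 h0
    apply h.ne_zero s.1
    rw [← h.star_mul_self, h1, mul_zero]
  obtain ⟨q, hq⟩ : ∃ q, S = {q} := by
    rw [← Finset.card_eq_one]
    refine le_antisymm hcard (Nat.one_le_iff_ne_zero.2 fun h0 ↦ hne ?_)
    rw [← hsum, Finset.card_eq_zero.1 h0, Finset.sum_empty]
  rw [← hsum, hq, Finset.sum_singleton]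
  exact hS q (by simp [hq])

end Bratteli

/-! ### Bratteli germs and continuity of the canonical trace -/

section Germs

set_option linter.unusedSectionVars false

variable {X : Type*} [TopologicalSpace X] {A : X → Type*} [∀ x, CStarAlgebra (A x)]
  [TopologicalSpace (TotSpace A)] [IsUnitalFellBundle A]

/-- The matrix units that extend those of a fibre span an extension of the fibre. -/
theorem isFiberExtension_of_isMatrixSystem {x : X} {k : ℕ} {m : Fin k → ℕ}
    {V : (Σ j, Fin (m j)) → ∀ y, A y} {P : Fin k → ∀ y, A y} (hV : ∀ s, V s ∈ ContSections A)
    {U : Set X} (hU : U ∈ 𝓝 x)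
    (hVU : ∀ y : U, IsMatrixSystem m (fun s ↦ V s (y : X)) (fun j ↦ P j (y : X)))
    (hx : Function.Surjective (hVU ⟨x, mem_of_mem_nhds hU⟩).hom) :
    IsFiberExtension A x U fun y ↦ (hVU y).hom.range := by
  have e : ∀ y : U, MultiMatrix m ≃ₗ[ℂ] (hVU y).hom.range := fun y ↦
    (StarAlgEquiv.ofInjective (hVU y).hom (hVU y).hom_injective).toAlgEquiv.toLinearEquiv
  refine ⟨hU, ?_, fun y ↦ (e y).finiteDimensional, fun y ↦ ?_, ?_⟩
  · rw [eq_top_iff]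
    intro a _
    exact hx a
  · rw [← (e y).finrank_eq]
    exact (LinearEquiv.ofBijective (hVU ⟨x, mem_of_mem_nhds hU⟩).hom.toAlgHom.toLinearMap
      ⟨(hVU ⟨x, mem_of_mem_nhds hU⟩).hom_injective, hx⟩).finrank_eq
  -- A fixed matrix `M`, inserted into the varying matrix units, is a continuous section through any
  -- given point.
  · refine isUnitalFellBundle_of_sections _ fun y b ↦ ?_
    obtain ⟨_, ⟨M, rfl⟩⟩ := b
    refine ⟨fun z ↦ ⟨(hVU z).hom M, M, rfl⟩, rfl, ?_⟩
    have h1 : (∑ j, ∑ a, ∑ b, M j a b • (V ⟨j, a⟩ * star (V ⟨j, b⟩))) ∈ ContSections A :=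
      sum_mem fun j _ ↦ sum_mem fun a _ ↦ sum_mem fun b _ ↦
        SMulMemClass.smul_mem _ (mul_mem (hV _) (star_mem (hV _)))
    refine ((mem_contSections.1 h1).comp continuous_subtype_val).congr fun z ↦ ?_
    have h2 : (∑ j, ∑ a, ∑ b, M j a b • (V ⟨j, a⟩ * star (V ⟨j, b⟩))) (z : X) = (hVU z).hom M := by
      rw [IsMatrixSystem.hom_apply, Finset.sum_apply]
      refine Finset.sum_congr rfl fun j _ ↦ ?_
      rw [Finset.sum_apply]
      refine Finset.sum_congr rfl fun a _ ↦ ?_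
      rw [Finset.sum_apply]
      rfl
    simp only [Function.comp_apply, h2]

variable [CompactSpace X] [T2Space X] [∀ x, FiniteDimensional ℂ (A x)] [∀ x, Nontrivial (A x)]

/-- If all Bratteli germs have singleton columns then a partition of the unit of a fibre into
minimal projections extends to nearby fibres. -/
theorem exists_local_minimal_partition {N : ℕ} (hN : ∀ x, Module.finrank ℂ (A x) ≤ N) (x : X)
    (hT : ∀ (l k : ℕ) (T : Matrix (Fin l) (Fin k) ℕ),
      IsBratteliGerm A x T → HasSingletonColumns T) :
    ∃ (ι : Type) (_ : Fintype ι) (P : ι → ∀ y, A y), (∀ i, P i ∈ ContSections A) ∧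
      ∀ᶠ y in 𝓝 x, (∀ i, IsMinimalProjection (P i y)) ∧ ∑ i, P i y = 1 := by
  obtain ⟨k, m, v, p, hm, h, hp, hb⟩ := exists_isMatrixSystem (A x)
  obtain ⟨V, P, hV, hVx, hPx, hVP⟩ := exists_lift_matrixSystem h hm
  refine ⟨Σ j, Fin (m j), inferInstance, fun s ↦ V s * star (V s),
    fun s ↦ mul_mem (hV s) (star_mem (hV s)), ?_⟩
  suffices hmin : ∀ᶠ y in 𝓝 x, ∀ s, IsMinimalProjection (V s y * star (V s y)) by
    filter_upwards [hmin, hVP] with y h1 h2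
    exact ⟨h1, h2.sum_eq_one⟩
  by_contra hcon
  let U : Set X := {y | IsMatrixSystem m (fun s ↦ V s y) (fun j ↦ P j y)}
  have hVU : ∀ y : U, IsMatrixSystem m (fun s ↦ V s (y : X)) (fun j ↦ P j (y : X)) := fun y ↦ y.2
  have hext : IsFiberExtension A x U fun y ↦ (hVU y).hom.range := by
    refine isFiberExtension_of_isMatrixSystem hV hVP hVU ?_
    refine (hVU ⟨x, mem_of_mem_nhds hVP⟩).hom_surjective (fun j ↦ ?_) fun s t hst a ↦ ?_
    · simp only [hPx]; exact hp j
    · simp only [hVx]; exact hb s t hst a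
  have hex : ∀ y : U, ∃ t : Σ l : Fin (N + 1), (Fin l → Fin k → Fin (N + 1)),
      IsBratteliMatrix (hVU y).hom.range.subtype (Matrix.of fun i j ↦ (t.2 i j : ℕ)) ∧
      (HasSingletonColumns (Matrix.of fun i j ↦ (t.2 i j : ℕ)) →
        ∀ s, IsMinimalProjection (V s (y : X) * star (V s (y : X)))) := by
    intro y
    obtain ⟨l, T, hl, hTN, h1, h2⟩ := (hVU y).exists_isBratteliMatrix hm (hN y)
    exact ⟨⟨⟨l, by omega⟩, fun i j ↦ ⟨T i j, by have := hTN i j; omega⟩⟩, h1, h2⟩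
  -- Pigeonhole: the bound `N` leaves finitely many candidate matrices, so if minimality is not
  -- eventual, one matrix without singleton columns occurs arbitrarily close to `x`.
  have hfreq : ∃ t : Σ l : Fin (N + 1), (Fin l → Fin k → Fin (N + 1)),
      ∃ᶠ y in 𝓝 x, ∃ hy : y ∈ U,
        IsBratteliMatrix (hVU ⟨y, hy⟩).hom.range.subtype (Matrix.of fun i j ↦ (t.2 i j : ℕ)) ∧
        ¬ HasSingletonColumns (Matrix.of fun i j ↦ (t.2 i j : ℕ)) := by
    by_contra! H
    rw [← eventually_all] at H
    refine hcon ?_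
    filter_upwards [H, hVP] with y h1 h2
    obtain ⟨t, ht, ht'⟩ := hex ⟨y, h2⟩
    exact ht' (h1 t h2 ht)
  obtain ⟨t, ht⟩ := hfreq
  have hgerm : IsBratteliGerm A x (Matrix.of fun i j ↦ (t.2 i j : ℕ)) :=
    ⟨U, _, hext, ht.mono fun y ⟨hy, h1⟩ ↦ ⟨hy, h1.1⟩⟩
  obtain ⟨y, hy, -, h1⟩ := ht.exists
  exact h1 (hT _ _ _ hgerm)

/-- If minimal partitions of the unit extend locally then the canonical traces form a continuous
field. -/
theorem continuous_canonicalTrace {τ : ∀ x, A x →ₗ[ℂ] ℂ} (hτ : ∀ x, IsCanonicalTrace (τ x))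
    (hloc : ∀ x, ∃ (ι : Type) (_ : Fintype ι) (P : ι → ∀ y, A y), (∀ i, P i ∈ ContSections A) ∧
      ∀ᶠ y in 𝓝 x, (∀ i, IsMinimalProjection (P i y)) ∧ ∑ i, P i y = 1)
    {s : ∀ x, A x} (hs : s ∈ ContSections A) : Continuous fun y ↦ τ y (s y) := by
  rw [continuous_iff_continuousAt]
  intro x
  obtain ⟨ι, _, P, hP, hPy⟩ := hloc x
  have hcoeff : ∀ y i (hp : IsMinimalProjection (P i y)),
      τ y (P i y * s y * P i y) = hp.coeff (s y) := by
    intro y i hp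
    rw [hp.mul_mul, map_smul, (hτ y).map_minimal _ hp, smul_eq_mul, mul_one]
  have hsum : (fun y ↦ ∑ i, τ y (P i y * s y * P i y)) =ᶠ[𝓝 x] fun y ↦ τ y (s y) := by
    filter_upwards [hPy] with y hy
    rw [(hτ y).eq_sum_coeff hy.1 hy.2]
    exact Finset.sum_congr rfl fun i _ ↦ hcoeff y i (hy.1 i)
  refine ContinuousAt.congr ?_ hsum
  refine tendsto_finsetSum _ fun i _ ↦ ?_
  have hx := hPy.self_of_nhds.1 i
  set c := hx.coeff (s x) with hc
  -- With `c` frozen at its value over `x`, this continuous section vanishes at `x`. Over `y` its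
  -- norm is the distance of the coefficient from `c`, as minimal projections have norm one.
  have ht : P i * s * P i - c • P i ∈ ContSections A :=
    sub_mem (mul_mem (mul_mem (hP i) hs) (hP i)) (SMulMemClass.smul_mem _ (hP i))
  have h0 := (continuous_norm_contSection ht).continuousAt (x := x)
  have hx0 : ‖(P i * s * P i - c • P i) x‖ = 0 := by
    rw [norm_eq_zero]
    change P i x * s x * P i x - c • P i x = 0
    rw [hx.mul_mul, sub_self]
  rw [ContinuousAt, hx0] at h0
  rw [hcoeff x i hx, ← hc, tendsto_iff_norm_sub_tendsto_zero]
  refine h0.congr' ?_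
  filter_upwards [hPy] with y hy
  have hp := hy.1 i
  rw [hcoeff y i hp]
  change ‖P i y * s y * P i y - c • P i y‖ = _
  rw [hp.mul_mul, ← sub_smul, norm_smul, hp.norm_eq, mul_one]

end Germs

/-! ### The normalized canonical trace and its `K`-constant -/

section Main

set_option linter.unusedSectionVars false

variable {X : Type*} [TopologicalSpace X] {A : X → Type*} [∀ x, CStarAlgebra (A x)]
  [TopologicalSpace (TotSpace A)] [IsUnitalFellBundle A]

theorem IsCanonicalTrace.exists_rank {B : Type*} [CStarAlgebra B] [FiniteDimensional ℂ B]
    [Nontrivial B] {τ : B →ₗ[ℂ] ℂ} (hτ : IsCanonicalTrace τ) :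
    ∃ n : ℕ, 1 ≤ n ∧ τ 1 = n ∧ algRank B = n ∧ ∀ a, ‖τ a‖ ≤ n * ‖a‖ := by
  obtain ⟨n, p, hp, -, h1⟩ := exists_minimal_partition B
  have h2 := hτ.one_eq_card hp h1
  have h3 := algRank_eq_card_of_minimal hp h1
  have h4 := hτ.norm_le hp h1
  rw [Fintype.card_fin] at h2 h3 h4
  refine ⟨n, ?_, h2, h3, h4⟩
  rw [Nat.one_le_iff_ne_zero]
  rintro rfl
  exact zero_ne_one (α := B) (by simp at h1)

/-- The expectation defined by a continuous field of traces. -/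
noncomputable def traceExpectation (τ : ∀ x, A x →ₗ[ℂ] ℂ) (h1 : ∀ x, τ x 1 ≠ 0)
    (hc : ∀ s ∈ ContSections A, Continuous fun y ↦ τ y (s y)) :
    ContSections A →ₗ[ℂ] C(X, ℂ) where
  toFun s := ⟨fun y ↦ (τ y 1)⁻¹ * τ y ((s : ∀ x, A x) y),
    ((hc 1 (one_mem _)).inv₀ h1).mul (hc _ s.2)⟩
  map_add' s t := by ext y; simp [mul_add]
  map_smul' c s := by ext y; simp [mul_left_comm]

variable [CompactSpace X] [T2Space X] [Nonempty X] [∀ x, Nontrivial (A x)]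
  [∀ x, FiniteDimensional ℂ (A x)] {τ : ∀ x, A x →ₗ[ℂ] ℂ}

theorem isExpectation_traceExpectation (hτ : ∀ x, IsCanonicalTrace (τ x)) (h1 : ∀ x, τ x 1 ≠ 0)
    (hc : ∀ s ∈ ContSections A, Continuous fun y ↦ τ y (s y)) :
    IsExpectation (traceExpectation τ h1 hc) := by
  have hscal : ∀ f, traceExpectation τ h1 hc (scalarSection A f) = f := by
    intro f
    ext y
    change (τ y 1)⁻¹ * τ y (f y • 1) = f y
    rw [map_smul, smul_eq_mul, mul_comm (f y), inv_mul_cancel_left₀ (h1 y)]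
  refine ⟨hscal, ⟨zero_le_one, fun s ↦ ?_⟩, fun C hC ↦ ?_⟩
  · have h0 : ∀ y, ‖(s : ∀ x, A x) y‖ ≤ supNorm s := fun y ↦
      le_ciSup (bddAbove_norm_section s) y
    rw [one_mul, ContinuousMap.norm_le _ ((norm_nonneg _).trans (h0 (Classical.arbitrary X)))]
    intro y
    obtain ⟨n, hn, hn1, -, hle⟩ := (hτ y).exists_rank
    change ‖(τ y 1)⁻¹ * τ y ((s : ∀ x, A x) y)‖ ≤ _
    have hn0 : (0 : ℝ) < n := by exact_mod_cast hn
    rw [hn1, norm_mul, norm_inv, Complex.norm_natCast]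
    calc (n : ℝ)⁻¹ * ‖τ y ((s : ∀ x, A x) y)‖ ≤ (n : ℝ)⁻¹ * (n * ‖(s : ∀ x, A x) y‖) := by
          gcongr; exact hle _
      _ = ‖(s : ∀ x, A x) y‖ := by field_simp
      _ ≤ _ := h0 y
  · have h2 := hC.2 (scalarSection A 1)
    have h3 : supNorm (scalarSection A (1 : C(X, ℂ))) = 1 := by
      have : ∀ y, ‖(scalarSection A (1 : C(X, ℂ)) : ∀ x, A x) y‖ = 1 := by
        intro y
        change ‖(1 : ℂ) • (1 : A y)‖ = 1
        rw [one_smul, CStarRing.norm_one]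
      rw [supNorm]
      simp only [this, ciSup_const]
    rwa [hscal, h3, mul_one, norm_one] at h2

/-- A self-adjoint continuous section with non-negative spectra is positive. -/
theorem isPositiveSection_of_spectrum (b : ContSections A)
    (hb : ∀ y, IsSelfAdjoint ((b : ∀ x, A x) y))
    (hs : ∀ y, ∀ r ∈ spectrum ℝ ((b : ∀ x, A x) y), 0 ≤ r) : IsPositiveSection b := by
  refine ⟨⟨_, cfc_mem_contSections b.2 hb Real.continuous_sqrt⟩, Subtype.ext (funext fun y ↦ ?_)⟩
  change (b : ∀ x, A x) y = star (cfc Real.sqrt ((b : ∀ x, A x) y)) * cfc Real.sqrt _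
  have h1 : star (cfc Real.sqrt ((b : ∀ x, A x) y)) = cfc Real.sqrt ((b : ∀ x, A x) y) :=
    (cfc_predicate _ _ : IsSelfAdjoint _)
  have hc := Real.continuous_sqrt.continuousOn (s := spectrum ℝ ((b : ∀ x, A x) y))
  rw [h1, ← cfc_mul _ _ _ hc hc]
  conv_lhs => rw [← cfc_id' ℝ ((b : ∀ x, A x) y) (hb y)]
  exact cfc_congr fun r hr ↦ (Real.mul_self_sqrt (hs y r hr)).symm

/-- The bound `≤` comes from `spectrum_le`, the factor `K / n y ≥ 1` absorbing the normalization.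
The bound `≥` comes from a continuous section through a minimal projection of each fibre. -/
theorem kConstant_traceExpectation (hτ : ∀ x, IsCanonicalTrace (τ x)) (h1 : ∀ x, τ x 1 ≠ 0)
    (hc : ∀ s ∈ ContSections A, Continuous fun y ↦ τ y (s y)) :
    kConstant (traceExpectation τ h1 hc) = bundleRank A := by
  choose n hn hn1 hnr hnle using fun x ↦ (hτ x).exists_rank
  refine le_antisymm ?_ ?_
  -- The rank of a fibre is the trace of its unit, a continuous function on a compact space.
  · have hfin : bundleRank A ≠ ∞ := by
      obtain ⟨M, hM⟩ := (isCompact_range (hc 1 (one_mem _)).norm).bddAbove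
      refine ne_top_of_le_ne_top (b := ENNReal.ofReal M) ENNReal.ofReal_ne_top (iSup_le fun x ↦ ?_)
      have h2 : ‖τ x 1‖ ≤ M := hM ⟨x, rfl⟩
      rw [hn1, Complex.norm_natCast] at h2
      rw [hnr, ← ENNReal.ofReal_natCast]
      exact ENNReal.ofReal_le_ofReal h2
    set K := (bundleRank A).toReal with hK
    have hnK : ∀ x, (n x : ℝ) ≤ K := by
      intro x
      have h2 : algRank (A x) ≤ bundleRank A := le_iSup (fun x ↦ algRank (A x)) x
      rw [hnr] at h2
      have h3 := ENNReal.toReal_mono hfin h2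
      simpa using h3
    have hK1 : 1 ≤ K := by
      have x := Classical.arbitrary X
      have h2 : (1 : ℝ) ≤ n x := by exact_mod_cast hn x
      exact h2.trans (hnK x)
    refine iInf₂_le_of_le K ⟨hK1, ?_⟩ (ENNReal.ofReal_toReal hfin).le
    rintro s ⟨t, rfl⟩
    have hval : ∀ y, ∃ c : ℝ, (∀ r ∈ spectrum ℝ (star ((t : ∀ x, A x) y) * (t : ∀ x, A x) y),
        r ≤ c) ∧ (((K : ℂ) • scalarSection A (traceExpectation τ h1 hc (star t * t)) - star t * t :
          ContSections A) : ∀ x, A x) y =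
          algebraMap ℝ (A y) c - star ((t : ∀ x, A x) y) * (t : ∀ x, A x) y := by
      intro y
      obtain ⟨d, hd, hdτ⟩ := (hτ y).star_mul_self ((t : ∀ x, A x) y)
      have hn0 : (1 : ℝ) ≤ n y := by exact_mod_cast hn y
      refine ⟨K * ((n y : ℝ)⁻¹ * d), fun r hr ↦ ?_, ?_⟩
      · have h2 := (hτ y).spectrum_le _ r hr
        rw [hdτ, Complex.ofReal_re] at h2
        refine h2.trans ?_
        rw [← mul_assoc]
        refine le_mul_of_one_le_left hd ?_
        rw [← div_eq_mul_inv, one_le_div (by linarith)]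
        exact hnK y
      · change (K : ℂ) • (((τ y 1)⁻¹ * τ y (star ((t : ∀ x, A x) y) * (t : ∀ x, A x) y)) • (1 : A y))
          - star ((t : ∀ x, A x) y) * (t : ∀ x, A x) y = _
        rw [hdτ, hn1, smul_smul, Algebra.algebraMap_eq_smul_one, ← Complex.coe_smul]
        push_cast
        rfl
    refine isPositiveSection_of_spectrum _ (fun y ↦ ?_) fun y r hr ↦ ?_
    · obtain ⟨c, -, hc'⟩ := hval y
      rw [hc']
      exact ((IsSelfAdjoint.all c).algebraMap _).sub (IsSelfAdjoint.star_mul_self _)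
    · obtain ⟨c, hc1, hc'⟩ := hval y
      rw [hc', ← spectrum.singleton_sub_eq] at hr
      obtain ⟨_, rfl, r', hr', rfl⟩ := hr
      exact sub_nonneg.2 (hc1 r' hr')
  · refine le_iInf₂ fun K hK ↦ iSup_le fun x ↦ ?_
    rw [hnr, ← ENNReal.ofReal_natCast]
    refine ENNReal.ofReal_le_ofReal ?_
    obtain ⟨p, hp, -⟩ := exists_isMinimalProjection_le (IsStarProjection.one (R := A x)) one_ne_zero
    obtain ⟨t, ht, htx⟩ := exists_contSection_eq p
    obtain ⟨u, hu⟩ := hK.2 _ ⟨⟨t, ht⟩, rfl⟩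
    have h2 := congrFun (congrArg Subtype.val hu) x
    change (K : ℂ) • (((τ x 1)⁻¹ * τ x (star (t x) * t x)) • (1 : A x)) - star (t x) * t x =
      star ((u : ∀ x, A x) x) * (u : ∀ x, A x) x at h2
    rw [htx, hp.1.star_eq, hp.1.mul_self, (hτ x).map_minimal p hp, hn1, mul_one, smul_smul] at h2
    -- Compressing to `p` leaves the scalar `K / n x - 1`, which must be non-negative.
    have h3 : star ((u : ∀ x, A x) x * p) * ((u : ∀ x, A x) x * p) =
        ((K : ℂ) * (n x : ℂ)⁻¹ - 1) • p := by
      calc _ = p * (star ((u : ∀ x, A x) x) * (u : ∀ x, A x) x) * p := by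
            rw [star_mul, hp.1.star_eq]; noncomm_ring
        _ = _ := by
            rw [← h2, mul_sub, sub_mul, hp.1.mul_self, hp.1.mul_self, mul_smul_comm, mul_one,
              smul_mul_assoc, hp.1.mul_self, sub_smul, one_smul]
    obtain ⟨r, hr, hr'⟩ := exists_nonneg_of_star_mul_self_eq_smul hp.1 hp.2.1 h3
    have h4 : K * (n x : ℝ)⁻¹ - 1 = r := by
      apply Complex.ofReal_injective
      push_cast
      exact hr'
    have h5 : (1 : ℝ) ≤ n x := by exact_mod_cast hn x
    rw [← div_eq_mul_inv] at h4
    rw [← one_le_div (by linarith)]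
    linarith

end Main

theorem mainTheorem11 {X : Type*} [TopologicalSpace X] [CompactSpace X] [T2Space X] [Nonempty X]
    (A : X → Type*) [∀ x, CStarAlgebra (A x)] [∀ x, Nontrivial (A x)]
    [TopologicalSpace (TotSpace A)] [IsUnitalFellBundle A] (hA : IsSubhomogeneous A)
    (hT : ∀ (x : X) (l k : ℕ) (T : Matrix (Fin l) (Fin k) ℕ),
      IsBratteliGerm A x T → HasSingletonColumns T) :
    ∃ E : ContSections A →ₗ[ℂ] C(X, ℂ), IsOptimalExpectation E := by
  obtain ⟨N, hN⟩ := hA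
  have hfd : ∀ x, FiniteDimensional ℂ (A x) := fun x ↦
    Module.rank_lt_aleph0_iff.1 ((hN x).trans_lt (Cardinal.natCast_lt_aleph0))
  have hfr : ∀ x, Module.finrank ℂ (A x) ≤ N := fun x ↦ Module.finrank_le_of_rank_le (hN x)
  choose τ hτ using fun x ↦ exists_isCanonicalTrace (A x)
  have hc : ∀ s ∈ ContSections A, Continuous fun y ↦ τ y (s y) := fun s hs ↦
    continuous_canonicalTrace hτ (fun x ↦ exists_local_minimal_partition hfr x (hT x)) hs
  have h1 : ∀ x, τ x 1 ≠ 0 := by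
    intro x
    obtain ⟨n, hn, hn1, -⟩ := (hτ x).exists_rank
    rw [hn1]
    exact_mod_cast (Nat.one_le_iff_ne_zero.1 hn)
  exact ⟨traceExpectation τ h1 hc, isExpectation_traceExpectation hτ h1 hc,
    kConstant_traceExpectation hτ h1 hc⟩
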